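/- **Setting.** Symbols are $\star,0,1$ and directions $\mathrm{In},\mathrm{Out}$. A *probabilistic two-way automaton $M$ with $k\ge 1$ heads and a pushdown stack* has a finite set $Q$ of states, with distinct initial, accepting and rejecting states, and, for each tuple $\vec s\in\{\star,0,1\}^k$ read by the heads, each last popped symbol $u$ (kept in a register) and each state $q$, a sub-probability distribution on pairs $(\nu,q')$. Here $\nu=(i,d',\iota)$ moves the head $i$ in the direction $d'$ ($\mathrm{Out}$: right, $\mathrm{In}$: left) and performs $\iota\in\{\mathrm{id},\mathtt{pop},\mathtt{push}_0,\mathtt{push}_1,\mathtt{push}_\star\}$ on the stack. The initial state is never re-entered, and there are no transitions of non-zero probability from the accepting and rejecting states. On a word $w=\star a_1\dots a_n$ (circular, of length $\lg(w)=n+1$), $M$ starts with all heads on $\star$, stack $\star$, and a fixed register content $u_0$; an empty stack cannot be popped. A *computation trace* is a finite sequence of successive performable transitions of non-zero probability from the initial configuration; its weight is the product of their probabilities. The *acceptance probability* is the probability of reaching the accepting state (the limit over $m$ of the probability of reaching it in at most $m$ steps). *Space.* Let $X=\mathbb R\times[0,1]^{\mathbb N}\times\{\star,0,1\}^{\mathbb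 N}$, with Lebesgue measure times the uniform product measure. Fix an injection $\Psi$ from $(\{\star,0,1\}\times\{\mathrm{In},\mathrm{Out}\})\cup\{\mathtt a,\mathtt r\}$ to intervals $[m,m+1]$, $m\in\mathbb Z$, and write $[f]_Y^Z=\Psi(f)\times Y\times Z$ (an omitted $Y$ or $Z$ is the whole space). $V(c)$ is the set of stacks with top symbol $c$. Weights lie in $\Omega=[0,1]\times\{0,1\}$, and $p\in[0,1]$ stands for $(p,0)$. *Word graphing.* $!W_w$ has, for each position $p\in\{0,\dots,n\}$ (with $a_0=\star$, positions mod $n+1$), edges of weight $1$ from $[(a_p,\mathrm{Out})]$ to $[(a_{p+1},\mathrm{In})]$ and from $[(a_p,\mathrm{In})]$ to $[(a_{p-1},\mathrm{Out})]$. They are defined where the first $[0,1]$-coordinate lies in $[\frac p{n+1},\frac{p+1}{n+1}]$; they translate the $\mathbb R$-coordinate, and translate that $[0,1]$-coordinate (mod 1) onto the interval of the new position. *Machine graphing.* $[M]$ has states $(q,\sigma,\vec s,u)\in Q\times\mathfrak S_k\times\{\star,0,1\}^k\times\{\star,0,1\}$: state, coordinate $\sigma(j)$ holding the position of each head $j$,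 last symbols read, last popped symbol. Each transition $t=((\vec s\,',u,q),((i,d',\iota),q'))$ of probability $p>0$ gives edges of weight $p$, as follows. - If $q$ is not initial: edges from $[(a,d)]$ in any state $(q,\sigma,\vec s,u)$ such that replacing $s_{\sigma^{-1}(1)}$ by $a$ in $\vec s$ gives $\vec s\,'$. - If $q$ is initial: only $\vec s\,'=(\star,\dots,\star)$ matters, with edges from $[v]^{V(\star)}$, $v\in\{\mathtt a,\mathtt r\}$, in the state $(\mathrm{init},\mathrm{Id},\vec\star,u)$. - If $\iota=\mathtt{pop}$, there is one such edge for each popped symbol $c$, with source restricted to $V(c)$ (only $c=\star$ when $q$ is initial), and the new register is $c$; otherwise the register is unchanged. - If $q'$ is not halting: the edge ends in $[(s'_i,d')]$ with state $(q',\tau_{1,\sigma(i)}\sigma,\vec s\,',\text{new register})$, and exchanges the coordinates $1$ and $\sigma(i)$. - If $q'$ is accepting (rejecting): it ends in $[\mathtt a]$ ($[\mathtt r]$) with state $(\mathrm{init},\mathrm{Id},\vec\star,\text{new register})$, and puts the first $k$ coordinates back in the order of the heads. - In each case it performs $\iota$ on the stack and translates the $\mathbb R$-coordinate between the intervals. *Paths.*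 An alternating path is a non-empty finite sequence of edges taken alternately from $[M]$ and $!W_w$; its weight is the product of the weights. Its domain is the set of points-with-states at which its edges compose. Let $Y=[0,1/\lg(w)]^k\times[0,1]^{\mathbb N}$. The path *has source $[\mathtt a]_Y$* if its domain contains almost all of $[\mathtt a]_Y^{V(\star)}$, in the state $(\mathrm{init},\mathrm{Id},\vec\star,u_0)$; it *has target $[\mathtt a]$* if it maps almost all of that set into $[\mathtt a]$. **Statement.** For every such $M$, $\Psi$, $u_0$ and every finite binary word $a_1\dots a_n$ ($n\ge0$), with $w=\star a_1\dots a_n$: 1. There is a weight-preserving bijection from the non-empty computation traces of $M$ on $w$ to the alternating paths of odd length between $[M]$ and $!W_w$ of source $[\mathtt a]_Y$. It sends a trace with $m$ transitions to a path of length $2m-1$ whose $[M]$-edges come, in order, from the transitions of the trace; the path has target $[\mathtt a]$ if and only if the trace ends in the accepting state. 2. The acceptance probability of $M$ on $w$ equals the sum of the weights of the alternating paths of source $[\mathtt a]_Y$ and target $[\mathtt a]$. 3. Suppose that whenever $M$ pops $\star$, every transition of non-zero probability from the state entered, with register $\star$, is one with $\iota=\mathtt{push}_\star$. Then every alternating path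 whose domain meets $[\mathtt a]_Y$, in the state $(\mathrm{init},\mathrm{Id},\vec\star,u_0)$, in a set of positive measure has source $[\mathtt a]_Y$. -/

import Mathlib

open MeasureTheory Filter
open scoped ENNReal

noncomputable section

namespace Graphings

/-! ### Symbols, vertices, and the space -/

/-- The three symbols `⋆, 0, 1`. -/
inductive Letter
  | star
  | zero
  | one
  deriving DecidableEq

instance : Fintype Letter := ⟨{.star, .zero, .one}, fun x => by cases x <;> simp⟩

/-- The two directions `In`, `Out`. -/
inductive Dir
  | inn
  | out
  deriving DecidableEq

instance : Fintype Dir := ⟨{.inn, .out}, fun x => by cases x <;> simp⟩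

/-- The two result vertices `a` (accept) and `r` (reject). -/
inductive Verdict
  | acc
  | rej
  deriving DecidableEq

instance : Fintype Verdict := ⟨{.acc, .rej}, fun x => by cases x <;> simp⟩

/-- The vertices: `({⋆,0,1} × {In,Out}) ∪ {a, r}`. -/
inductive Vertex
  | ext (s : Letter) (d : Dir)
  | res (v : Verdict)
  deriving DecidableEq

instance : Nonempty Letter := ⟨Letter.star⟩

instance : MeasurableSpace Letter := ⊤

instance : DiscreteMeasurableSpace Letter := ⟨fun _ => trivial⟩

/-- The space `ℝ × [0,1]^ℕ × {⋆,0,1}^ℕ`. -/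
abbrev Pt : Type := ℝ × (ℕ → unitInterval) × (ℕ → Letter)

/-- Lebesgue measure on `ℝ × [0,1]^ℕ`, times the measure on `{⋆,0,1}^ℕ` giving mass `3^{-n}` to the
cylinder of any word of length `n`. -/
def mu : Measure Pt :=
  (volume : Measure ℝ).prod
    ((Measure.infinitePi fun _ : ℕ => (volume : Measure unitInterval)).prod
      (Measure.infinitePi fun _ : ℕ => (PMF.uniformOfFintype Letter).toMeasure))

/-- `a · s`: the sequence with first element `a`, followed by `s`. -/
def cons {α : Type*} (a : α) (s : ℕ → α) : ℕ → α
  | 0 => a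
  | n + 1 => s n

/-- The sequence `s` without its first element. -/
def tail {α : Type*} (s : ℕ → α) : ℕ → α := fun n => s (n + 1)

/-- The cylinder `V(c)` of stacks with top symbol `c`. -/
def cyl (c : Letter) : Set (ℕ → Letter) := {π | π 0 = c}

/-- The set `⟦f⟧_Y^Z = Ψ(f) × Y × Z`, where `Ψ(f)` is the interval `[Ψ f, Ψ f + 1]`. -/
def box (Ψ : Vertex → ℤ) (f : Vertex) (Y : Set (ℕ → unitInterval)) (Z : Set (ℕ → Letter)) : Set Pt :=
  {p | p.1 ∈ Set.Icc (Ψ f : ℝ) (Ψ f + 1) ∧ p.2.1 ∈ Y ∧ p.2.2 ∈ Z}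

/-! ### Microcosms -/

/-- The monoid of all measurable maps. -/
def macrocosm : Submonoid (Function.End Pt) where
  carrier := {f | Measurable f}
  one_mem' := measurable_id
  mul_mem' := fun ha hb => Measurable.comp ha hb

/-- The translation `t_z`. -/
def translate (z : ℤ) : Function.End Pt := fun p => (p.1 + z, p.2.1, p.2.2)

/-- The permutation `p_ρ`, acting on sequences by `(ρ s)(n) = s (ρ⁻¹ n)`. -/
def permute (ρ : Equiv.Perm ℕ) : Function.End Pt := fun p => (p.1, fun n => p.2.1 (ρ⁻¹ n), p.2.2)

/-- The map `pop`. -/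
def popMap : Function.End Pt := fun p => (p.1, p.2.1, tail p.2.2)

/-- The map `push_c`. -/
def pushMap (c : Letter) : Function.End Pt := fun p => (p.1, p.2.1, cons c p.2.2)

/-- The microcosm `𝔫_k`, generated by the integer translations, the permutations of the first `k`
coordinates, `pop`, and the three maps `push_c`. -/
def microN (k : ℕ) : Submonoid (Function.End Pt) :=
  Submonoid.closure
    (Set.range translate ∪ {f | ∃ ρ : Equiv.Perm ℕ, (∀ n, k ≤ n → ρ n = n) ∧ f = permute ρ} ∪
      {popMap} ∪ Set.range pushMap)

/-! ### Graphing representatives -/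

/-- The monoid of weights `Ω = [0,1] × {0,1}`; `(a, 0)` is written `a` and `(a, 1)` is `a·𝟏`. -/
abbrev Weight : Type := unitInterval × ZMod 2

/-- An `Ω`-weighted `𝔪`-graphing representative with stateset `D` and edges `E`. -/
structure GraphingRep (𝔪 : Submonoid (Function.End Pt)) (D E : Type*) [Finite D] [Countable E] where
  /-- the support -/
  support : Set Pt
  measurable_support : MeasurableSet support
  /-- the source of an edge is `src e × {inSt e}` -/
  src : E → Set Pt
  inSt : E → D
  outSt : E → D
  /-- the realiser -/
  real : E → Function.End Pt
  weight : E → Weight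
  measurable_src : ∀ e, MeasurableSet (src e)
  src_subset : ∀ e, src e ⊆ support
  real_mem : ∀ e, real e ∈ 𝔪
  maps_to : ∀ e, Set.MapsTo (real e) (src e) support

/-! ### Alternating paths between two graphings

A path acts on `Pt × D × D'`: the edges of the first graphing change the `D`-component of the state
and leave the `D'`-component fixed, those of the second do the converse. -/

section Paths

variable {𝔪 𝔪' : Submonoid (Function.End Pt)} {D D' E E' : Type*}
  [Finite D] [Finite D'] [Countable E] [Countable E']

/-- The successive edges belong alternately to the first and to the second graphing. -/
def IsAlternating (l : List (E ⊕ E')) : Prop :=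
  l ≠ [] ∧ l.IsChain (fun e f => e.isLeft ≠ f.isLeft)

/-- The set of points (with states) at which an edge is defined. -/
def edgeDom (F : GraphingRep 𝔪 D E) (G : GraphingRep 𝔪' D' E') : E ⊕ E' → Set (Pt × D × D')
  | .inl e => {p | p.1 ∈ F.src e ∧ p.2.1 = F.inSt e}
  | .inr e => {p | p.1 ∈ G.src e ∧ p.2.2 = G.inSt e}

/-- The action of an edge on points with states. -/
def edgeMap (F : GraphingRep 𝔪 D E) (G : GraphingRep 𝔪' D' E') :
    E ⊕ E' → Pt × D × D' → Pt × D × D'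
  | .inl e => fun p => (F.real e p.1, F.outSt e, p.2.2)
  | .inr e => fun p => (G.real e p.1, p.2.1, G.outSt e)

/-- The source `S_π` of a path `π`: all points at which its edges can be composed. -/
def pathDom (F : GraphingRep 𝔪 D E) (G : GraphingRep 𝔪' D' E') :
    List (E ⊕ E') → Set (Pt × D × D')
  | [] => Set.univ
  | e :: l => edgeDom F G e ∩ edgeMap F G e ⁻¹' pathDom F G l

/-- The map `φ_π` realised by a path `π`. -/
def pathMap (F : GraphingRep 𝔪 D E) (G : GraphingRep 𝔪' D' E') :
    List (E ⊕ E') → Pt × D × D' → Pt × D × D'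
  | [] => id
  | e :: l => pathMap F G l ∘ edgeMap F G e

/-- The weight of a path: the product, in `Ω`, of the weights of its edges. -/
def pathWeight (F : GraphingRep 𝔪 D E) (G : GraphingRep 𝔪' D' E') (l : List (E ⊕ E')) : Weight :=
  (l.map (Sum.elim F.weight G.weight)).prod

/-- The path `l` can be restricted to the source `B × {δ}`: up to a null set, all of `B × {δ}` lies in
the domain of the path. -/
def HasSource (F : GraphingRep 𝔪 D E) (G : GraphingRep 𝔪' D' E') (B : Set Pt) (δ : D × D')
    (l : List (E ⊕ E')) : Prop :=
  ∀ᵐ x ∂mu, x ∈ B → (x, δ) ∈ pathDom F G l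

/-- Up to a null set, the path `l` maps `B × {δ}` into `C` (with any state). -/
def HasTarget (F : GraphingRep 𝔪 D E) (G : GraphingRep 𝔪' D' E') (B : Set Pt) (δ : D × D')
    (C : Set Pt) (l : List (E ⊕ E')) : Prop :=
  ∀ᵐ x ∂mu, x ∈ B → (pathMap F G l (x, δ)).1 ∈ C

end Paths

/-! ### Word graphings -/

/-- The letter of `{⋆,0,1}` for a bit. -/
def Letter.ofBit : Bool → Letter
  | false => .zero
  | true => .one

/-- The word `⋆ a₁ … aₙ`, of length `n + 1`. -/
def tape (w : List Bool) : Fin (w.length + 1) → Letter :=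
  Fin.cons Letter.star fun j => Letter.ofBit (w.get j)

/-- Moving on the circular word `⋆ a₁ … aₙ`: to the right for `Out`, to the left for `In`. -/
def Dir.move {n : ℕ} : Dir → Fin (n + 1) → Fin (n + 1)
  | .out, p => p + 1
  | .inn, p => p - 1

/-- A head that leaves a cell by `Out` enters the next one by `In`, and conversely. -/
def Dir.flip : Dir → Dir
  | .out => .inn
  | .inn => .out

theorem measurableSet_box (Ψ : Vertex → ℤ) (f : Vertex) {Y : Set (ℕ → unitInterval)}
    {Z : Set (ℕ → Letter)} (hY : MeasurableSet Y) (hZ : MeasurableSet Z) :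
    MeasurableSet (box Ψ f Y Z) :=
  (measurable_fst measurableSet_Icc).inter
    ((measurable_snd.fst hY).inter (measurable_snd.snd hZ))

theorem measurable_translate (z : ℤ) : Measurable (translate z) :=
  (measurable_fst.add_const _).prodMk (measurable_snd.fst.prodMk measurable_snd.snd)

theorem translate_mem_box {Ψ : Vertex → ℤ} {f g : Vertex} {Y Y' : Set (ℕ → unitInterval)}
    {Z Z' : Set (ℕ → Letter)} {p q : Pt} (hp : p ∈ box Ψ f Y Z) (hq : q.1 = p.1)
    (hY : q.2.1 ∈ Y') (hZ : q.2.2 ∈ Z') : translate (Ψ g - Ψ f) q ∈ box Ψ g Y' Z' := by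
  obtain ⟨⟨h1, h2⟩, -⟩ := hp
  refine ⟨⟨?_, ?_⟩, hY, hZ⟩ <;> simp only [translate, hq] <;> push_cast <;> linarith

/-- The word graphing of `⋆ a₁ … aₙ`, with states the positions `0, …, n`, and two edges for each
position `i`: `(Out, i)`, from `(a_i, Out, i)` to `(a_{i+1}, In, i+1)`, and `(In, i)`, from
`(a_i, In, i)` to `(a_{i-1}, Out, i-1)`, positions being taken modulo `n + 1`. -/
def wordGraphing (Ψ : Vertex → ℤ) (w : List Bool) :
    GraphingRep macrocosm (Fin (w.length + 1)) (Dir × Fin (w.length + 1)) where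
  support := ⋃ (f : Letter × Dir), box Ψ (.ext f.1 f.2) Set.univ Set.univ
  measurable_support := by
    have : Finite (Letter × Dir) := inferInstance
    exact MeasurableSet.iUnion fun f => measurableSet_box Ψ _ .univ .univ
  src := fun e => box Ψ (.ext (tape w e.2) e.1) Set.univ Set.univ
  inSt := fun e => e.2
  outSt := fun e => e.1.move e.2
  real := fun e =>
    translate (Ψ (.ext (tape w (e.1.move e.2)) e.1.flip) - Ψ (.ext (tape w e.2) e.1))
  weight := fun _ => (1, 0)
  measurable_src := fun _ => measurableSet_box Ψ _ .univ .univ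
  src_subset := fun e p hp => Set.mem_iUnion.2 ⟨(tape w e.2, e.1), hp⟩
  real_mem := fun _ => measurable_translate _
  maps_to := fun e p hp => Set.mem_iUnion.2 ⟨(tape w (e.1.move e.2), e.1.flip),
    translate_mem_box hp rfl trivial trivial⟩

/-- The fractional part `a ∔ t` of `a + t`, as a point of `[0,1]`. -/
def addFract (a : unitInterval) (t : ℝ) : unitInterval :=
  ⟨Int.fract ((a : ℝ) + t), Int.fract_nonneg _, (Int.fract_lt_one _).le⟩

/-- The space without its first `[0,1]`-coordinate. -/
def dropFirst (p : Pt) : Pt := (p.1, tail p.2.1, p.2.2)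

theorem measurable_dropFirst : Measurable dropFirst :=
  measurable_fst.prodMk ((measurable_pi_lambda _ fun n =>
    (measurable_pi_apply (n + 1)).comp measurable_snd.fst).prodMk measurable_snd.snd)

/-- The exponential `!A` of a graphing `A` with states `0, …, N-1`: the states are moved into the
first `[0,1]`-coordinate, the state `i` being represented by the interval `[i/N, (i+1)/N]`, and the
resulting graphing has a single state. An edge of `A` from the state `i` to the state `j` realised by
`φ` becomes `(x, a·s, π) ↦ (y, (a ∔ (j-i)/N)·s', π')`, where `(y, s', π') = φ(x, s, π)`. -/
def bang {N : ℕ} {E : Type*} [Countable E] (A : GraphingRep macrocosm (Fin N) E) :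
    GraphingRep macrocosm Unit E where
  support := dropFirst ⁻¹' A.support
  measurable_support := measurable_dropFirst A.measurable_support
  src := fun e => {p | dropFirst p ∈ A.src e ∧
    (p.2.1 0 : ℝ) ∈ Set.Icc ((A.inSt e : ℕ) / (N : ℝ)) (((A.inSt e : ℕ) + 1) / (N : ℝ))}
  inSt := fun _ => ()
  outSt := fun _ => ()
  real := fun e p =>
    ((A.real e (dropFirst p)).1,
      cons (addFract (p.2.1 0) ((((A.outSt e : ℕ) : ℝ) - ((A.inSt e : ℕ) : ℝ)) / N))
        (A.real e (dropFirst p)).2.1,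
      (A.real e (dropFirst p)).2.2)
  weight := A.weight
  measurable_src := fun e =>
    (measurable_dropFirst (A.measurable_src e)).inter
      ((measurable_subtype_coe.comp ((measurable_pi_apply 0).comp measurable_snd.fst))
        measurableSet_Icc)
  src_subset := fun e p hp => A.src_subset e hp.1
  real_mem := fun e => by
    have h : Measurable fun p : Pt => A.real e (dropFirst p) :=
      Measurable.comp (A.real_mem e) measurable_dropFirst
    refine h.fst.prodMk (Measurable.prodMk (measurable_pi_lambda _ fun n => ?_) h.snd.snd)
    cases n with
    | zero =>
      refine Measurable.subtype_mk (measurable_fract.comp (Measurable.add_const ?_ _))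
      exact measurable_subtype_coe.comp ((measurable_pi_apply 0).comp measurable_snd.fst)
    | succ n => exact (measurable_pi_apply n).comp h.snd.fst
  maps_to := fun e p hp => A.maps_to e hp.1

/-! ### Probabilistic two-way multihead automata with a pushdown stack -/

/-- Stack instructions. -/
inductive StackOp
  | id
  | pop
  | push (c : Letter)
  deriving DecidableEq, Fintype

/-- Instructions: move one head in one direction, and perform a stack instruction. -/
abbrev Inst (k : ℕ) : Type := Fin k × Dir × StackOp

/-- A probabilistic two-way automaton with `k` heads and a pushdown stack, with states `Q`.
`prob s u q` is the sub-probability distribution of the next transition, in the state `q`, when the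
heads read `s` and the register holding the last popped symbol contains `u`. The initial state is never
entered again, and the computation stops in the accepting and in the rejecting state. -/
structure Automaton (k : ℕ) (Q : Type*) [Fintype Q] where
  prob : (Fin k → Letter) → Letter → Q → Inst k × Q → unitInterval
  sum_le_one : ∀ s u q, ∑ t, (prob s u q t : ℝ) ≤ 1
  qInit : Q
  qAcc : Q
  qRej : Q
  init_ne_acc : qInit ≠ qAcc
  init_ne_rej : qInit ≠ qRej
  acc_ne_rej : qAcc ≠ qRej
  prob_init : ∀ s u q ν, prob s u q (ν, qInit) = 0
  prob_acc : ∀ s u t, prob s u qAcc t = 0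
  prob_rej : ∀ s u t, prob s u qRej t = 0

/-- Configurations on a word of length `N`: the state, the positions of the heads, the last popped
symbol, and the stack (top first). -/
structure Config (k N : ℕ) (Q : Type*) where
  state : Q
  pos : Fin k → Fin N
  reg : Letter
  stack : List Letter

namespace Automaton

variable {k : ℕ} {Q : Type*} [Fintype Q] (M : Automaton k Q) (w : List Bool)

/-- The initial configuration: all heads on the marker `⋆`, the stack consisting of the symbol `⋆`;
`u` is the initial content of the register. -/
def start (u : Letter) : Config k (w.length + 1) Q := ⟨M.qInit, fun _ => 0, u, [Letter.star]⟩

/-- The probability of the transition `t` in a configuration. -/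
def stepProb (c : Config k (w.length + 1) Q) (t : Inst k × Q) : unitInterval :=
  M.prob (fun j => tape w (c.pos j)) c.reg c.state t

/-- Register and stack after a stack instruction; `pop` is impossible on the empty stack. -/
def _root_.Graphings.StackOp.exec : StackOp → Letter → List Letter → Option (Letter × List Letter)
  | .id, u, γ => some (u, γ)
  | .push c, u, γ => some (u, c :: γ)
  | .pop, _, c :: γ => some (c, γ)
  | .pop, _, [] => none

/-- The configuration after a transition, if it can be performed. -/
def _root_.Graphings.Config.next {n : ℕ} (c : Config k (n + 1) Q) (t : Inst k × Q) :
    Option (Config k (n + 1) Q) :=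
  (t.1.2.2.exec c.reg c.stack).map fun r =>
    ⟨t.2, Function.update c.pos t.1.1 (t.1.2.1.move (c.pos t.1.1)), r.1, r.2⟩

/-- Computation traces from a configuration: finite sequences of successive transitions of non-zero
probability. -/
def IsTraceFrom : Config k (w.length + 1) Q → List (Inst k × Q) → Prop
  | _, [] => True
  | c, t :: l => 0 < M.stepProb w c t ∧ ∃ c', c.next t = some c' ∧ IsTraceFrom c' l

/-- The weight of a trace: the product of the probabilities of its transitions. -/
def traceWeightFrom : Config k (w.length + 1) Q → List (Inst k × Q) → unitInterval
  | _, [] => 1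
  | c, t :: l => M.stepProb w c t *
      (match c.next t with
        | none => 0
        | some c' => traceWeightFrom c' l)

/-- The probability of reaching the accepting state in at most `n` steps. -/
def acceptWithin : ℕ → Config k (w.length + 1) Q → ℝ≥0∞
  | 0, c => by classical exact if c.state = M.qAcc then 1 else 0
  | n + 1, c => by classical exact
      if c.state = M.qAcc then 1 else
        ∑ t : (Inst k × Q), ENNReal.ofReal (M.stepProb w c t) *
          (match c.next t with
            | none => 0
            | some c' => acceptWithin n c')

/-- The probability that `M`, with initial register `u`, accepts `w`. -/
def acceptProb (u : Letter) : ℝ≥0∞ := ⨆ n, M.acceptWithin w n (M.start w u)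

/-- Whenever the symbol `⋆` is popped, it is pushed again by the next transition. -/
def RestoresStar : Prop :=
  ∀ s u q i d q', 0 < M.prob s u q ((i, d, StackOp.pop), q') →
    ∀ s' i' d' ι' q'', 0 < M.prob s' Letter.star q' ((i', d', ι'), q'') → ι' = StackOp.push Letter.star

/-! ### The graphing of an automaton -/

/-- The verdict given by a halting state. -/
def verdict (q : Q) : Option Verdict := by
  classical exact if q = M.qAcc then some .acc else if q = M.qRej then some .rej else none

end Automaton

/-- The stack instructions, with the popped symbol made explicit in the case of `pop`. -/
inductive StackAct
  | id
  | pop (c : Letter)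
  | push (c : Letter)
  deriving DecidableEq, Fintype

namespace StackAct

def op : StackAct → StackOp
  | .id => .id
  | .pop _ => .pop
  | .push c => .push c

/-- The stacks on which the action is defined: `V(c)` for `pop c`. -/
def dom : StackAct → Set (ℕ → Letter)
  | .pop c => cyl c
  | _ => Set.univ

def map : StackAct → Function.End Pt
  | .id => 1
  | .pop _ => popMap
  | .push c => pushMap c

/-- The new content of the register. -/
def reg : StackAct → Letter → Letter
  | .pop c, _ => c
  | _, u => u

end StackAct

/-- The stateset of the graphing of an automaton: state, permutation of the heads, last symbols read by
the heads, last popped symbol. -/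
abbrev MState (k : ℕ) (Q : Type*) : Type _ := Q × Equiv.Perm (Fin k) × (Fin k → Letter) × Letter

/-- Where an edge of the graphing of an automaton starts: either at one of the two result vertices,
with initial register `u`, or at the vertex `(a, d)` in a given state. -/
abbrev MSource (k : ℕ) (Q : Type*) : Type _ := (Verdict × Letter) ⊕ (Letter × Dir × MState k Q)

/-- What an edge of the graphing of an automaton does. -/
abbrev MLabel (k : ℕ) (Q : Type*) : Type _ := (Fin k × Dir × StackAct) × Q

namespace Automaton

variable {k : ℕ} {Q : Type*} [Fintype Q] (M : Automaton k Q)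

/-- The transition underlying an edge. -/
def _root_.Graphings.MLabel.trans (t : MLabel k Q) : Inst k × Q :=
  ((t.1.1, t.1.2.1, t.1.2.2.op), t.2)

section

variable [NeZero k]

/-- The vertex at which an edge starts. -/
def srcVertex : MSource k Q → Vertex
  | .inl (v, _) => .res v
  | .inr (a, d, _) => .ext a d

/-- The state from which an edge starts: `(init, Id, (⋆,…,⋆), u)` for the edges of the initial state. -/
def srcState : MSource k Q → MState k Q
  | .inl (_, u) => (M.qInit, 1, fun _ => Letter.star, u)
  | .inr (_, _, δ) => δ

/-- The symbols that are read by the heads: for an edge starting at `(a, d)`, the symbol `a` is the one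
read by the head that moved last, i.e. the head `σ⁻¹(0)`. -/
def reading : MSource k Q → Fin k → Letter
  | .inl _ => fun _ => Letter.star
  | .inr (a, _, _, σ, s, _) => Function.update s (σ⁻¹ 0) a

/-- The edges: the transitions of non-zero probability out of `init` give edges from the result
vertices, and all others give edges from the vertices `(a, d)`. The initial stack starts with `⋆`, so
that only `⋆` can be popped in the state `init`. -/
def IsEdge (e : MSource k Q × MLabel k Q) : Prop :=
  0 < M.prob (reading e.1) (M.srcState e.1).2.2.2 (M.srcState e.1).1 e.2.trans ∧
    match e.1 with
    | .inl _ => ∀ c, e.2.1.2.2 = StackAct.pop c → c = Letter.star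
    | .inr (_, _, δ) => δ.1 ≠ M.qInit

abbrev Edge : Type _ := {e : MSource k Q × MLabel k Q // M.IsEdge e}

/-- The stacks on which an edge is defined. -/
def srcStack (e : MSource k Q × MLabel k Q) : Set (ℕ → Letter) :=
  match e.1 with
  | .inl _ => cyl Letter.star
  | .inr _ => e.2.1.2.2.dom

/-- The vertex at which an edge ends: the result vertex if the transition enters a halting state,
and otherwise `(s_i, d')`, where the head `i` is moved in the direction `d'`. -/
def tgtVertex (e : MSource k Q × MLabel k Q) : Vertex :=
  match M.verdict e.2.2 with
  | some v => .res v
  | none => .ext (reading e.1 e.2.1.1) e.2.1.2.1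

/-- The permutation of the coordinates that an edge realises: the coordinate `σ(i)` of the head `i` that
is moved is exchanged with the first one; on halting, the heads are put back in their original
order. -/
def edgePerm (e : MSource k Q × MLabel k Q) : Equiv.Perm (Fin k) :=
  match M.verdict e.2.2 with
  | some _ => (M.srcState e.1).2.1⁻¹
  | none => Equiv.swap 0 ((M.srcState e.1).2.1 e.2.1.1)

/-- The state in which an edge ends. -/
def tgtState (e : MSource k Q × MLabel k Q) : MState k Q :=
  match M.verdict e.2.2 with
  | some _ => (M.qInit, 1, fun _ => Letter.star, e.2.1.2.2.reg (M.srcState e.1).2.2.2)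
  | none => (e.2.2, M.edgePerm e * (M.srcState e.1).2.1, reading e.1,
      e.2.1.2.2.reg (M.srcState e.1).2.2.2)

theorem measurableSet_cyl (c : Letter) : MeasurableSet (cyl c) :=
  measurable_pi_apply (X := fun _ : ℕ => Letter) 0 (MeasurableSet.of_discrete (s := {c}))

/-- The graphing of the automaton `M`, with realisers in the microcosm `𝔫_k`. -/
def graphing (Ψ : Vertex → ℤ) : GraphingRep (microN k) (MState k Q) M.Edge where
  support := ⋃ f : Vertex, box Ψ f Set.univ Set.univ
  measurable_support := by
    have : Countable Vertex := by
      refine Function.Injective.countable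
        (f := fun x : Vertex => (match x with
          | .ext s d => Sum.inl (s, d)
          | .res v => Sum.inr v : (Letter × Dir) ⊕ Verdict)) ?_
      rintro (⟨s, d⟩ | v) (⟨s', d'⟩ | v') h <;> simp_all
    exact MeasurableSet.iUnion fun f => measurableSet_box Ψ _ .univ .univ
  src := fun e => box Ψ (srcVertex e.1.1) Set.univ (srcStack e.1)
  inSt := fun e => M.srcState e.1.1
  outSt := fun e => M.tgtState e.1
  real := fun e =>
    translate (Ψ (M.tgtVertex e.1) - Ψ (srcVertex e.1.1)) *
      (permute ((M.edgePerm e.1).viaEmbedding Fin.valEmbedding) * e.1.2.1.2.2.map)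
  weight := fun e => (M.prob (reading e.1.1) (M.srcState e.1.1).2.2.2 (M.srcState e.1.1).1
    e.1.2.trans, 0)
  measurable_src := fun e => by
    refine measurableSet_box Ψ _ .univ ?_
    unfold srcStack
    split
    · exact measurableSet_cyl _
    · cases e.1.2.1.2.2 with
      | pop c => exact measurableSet_cyl c
      | id => exact .univ
      | push c => exact .univ
  src_subset := fun e p hp => Set.mem_iUnion.2 ⟨srcVertex e.1.1, hp.1, trivial, trivial⟩
  real_mem := fun e => by
    refine mul_mem (Submonoid.subset_closure (Or.inl (Or.inl (Or.inl ⟨_, rfl⟩))))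
      (mul_mem (Submonoid.subset_closure (Or.inl (Or.inl (Or.inr ⟨_, fun n hn => ?_, rfl⟩)))) ?_)
    · refine Equiv.Perm.viaEmbedding_apply_of_notMem _ _ _ ?_
      rintro ⟨j, rfl⟩
      exact absurd j.2 (not_lt.2 hn)
    · cases e.1.2.1.2.2 with
      | id => exact one_mem _
      | pop c => exact Submonoid.subset_closure (Or.inl (Or.inr rfl))
      | push c => exact Submonoid.subset_closure (Or.inr ⟨c, rfl⟩)
  maps_to := fun e p hp => by
    refine Set.mem_iUnion.2 ⟨M.tgtVertex e.1, translate_mem_box hp ?_ trivial trivial⟩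
    cases h : e.1.2.1.2.2 <;> rfl

/-- The state `(init, Id, (⋆,…,⋆), u)`, paired with the only state of `!W_w`. -/
def startState (u : Letter) : MState k Q × Unit := ((M.qInit, 1, fun _ => Letter.star, u), ())

end

/-- The transitions underlying the edges of the automaton in an alternating path. -/
def pathTransitions [NeZero k] {E' : Type*} (l : List (M.Edge ⊕ E')) : List (Inst k × Q) :=
  (l.filterMap Sum.getLeft?).map fun e => e.1.2.trans

end Automaton

/-- The set `Y = [0, 1/N]^k × [0,1]^ℕ`. -/
def cube (k N : ℕ) : Set (ℕ → unitInterval) := {s | ∀ j < k, (s j : ℝ) ≤ 1 / N}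

end Graphings

end

open Graphings

/-!
A path from `[M]` and `!W_w` is followed on *regions*: symbolic sets of points in which the vertex, the
state of `[M]`, the cell of the word containing each of the first `k` coordinates, and a finite top
part of the stack are known, the rest of the stack being arbitrary. Intervals are taken open, which
loses only a null set and makes distinct vertices and distinct cells disjoint. An edge is then either
defined on a whole region, which it maps into another one (`Allows.mem_edgeDom`, `Allows.edgeMap_mem`),
or defined nowhere on it, with one exception: an edge that requires a top symbol `c` when the
known stack is empty is defined at the points whose unknown stack starts with `c`. It then fails for
the other symbols, hence on a set of positive measure, so a path has source `[a]_Y` if and only if it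
can be followed on regions from the starting region (`hasSource_iff_allowsPath`).

A region describes a configuration of `M` (`Matches`) when coordinate `σ(j)` lies in the cell of head
`j` and the symbol at the current vertex completes the symbols read. On such a region, the edges of
`[M]` that are allowed correspond to the transitions that can be performed (`Matches.exists_edge`,
`Allows.edge_unique`), and a transition into a non-halting state is followed by exactly one edge of the
word, which leads to a region describing the next configuration (`Matches.round`). After a
halting transition the path stands at a result vertex, where no edge of the word starts. Hence taking the
underlying transitions is a bijection from paths of odd length to traces (`bijOn_pathTransitions`).

Unfolding the recursion for the acceptance probability writes it as a sum over traces
(`acceptProb_eq_tsum_traces`), and the bijection turns it into a sum over paths; those of even length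
end with an edge of the word and so do not have target `[a]`.

If popped symbols `⋆` are restored, the known stack is empty only just after its last `⋆` has been
popped, and the next transition is a `push`. The exceptional edges never occur, so a path defined at one
generic point of `[a]_Y` can be followed on regions (`StarAtBottom.allowsPath`).
-/

noncomputable section

namespace Graphings

/-! ### Regions -/

/-- The stack with the finite word `γ` on top of `π`. -/
def prepend (γ : List Letter) (π : ℕ → Letter) : ℕ → Letter := γ.foldr cons π

/-- A symbolic description of a set of points with states: the vertex, the state of the automaton
graphing, the cell of the word in which each of the first `k` coordinates lies, and the known part of
the stack (top first). Positions are indexed by coordinates, not by heads. -/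
structure Region (k N : ℕ) (Q : Type*) where
  vertex : Vertex
  st : MState k Q
  pos : Fin k → Fin N
  stack : List Letter

namespace Region

/-- The points described by a region, when the unknown part of the stack is `π`. The intervals are
open, so that distinct vertices and distinct cells give disjoint sets. -/
def pts {k N : ℕ} {Q : Type*} (Ψ : Vertex → ℤ) (S : Region k N Q) (π : ℕ → Letter) : Set Pt :=
  {x | x.1 ∈ Set.Ioo (Ψ S.vertex : ℝ) (Ψ S.vertex + 1) ∧
    (∀ j : Fin k, (x.2.1 j : ℝ) ∈
      Set.Ioo ((S.pos j : ℕ) / (N : ℝ)) (((S.pos j : ℕ) + 1) / (N : ℝ))) ∧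
    x.2.2 = prepend S.stack π}

end Region

/-- The known part of the stack after a stack action. -/
def StackAct.onList : StackAct → List Letter → List Letter
  | .id, γ => γ
  | .pop _, γ => γ.tail
  | .push c, γ => c :: γ

/-- The top symbol that an edge of the graphing of an automaton requires, if any. -/
def edgeTop {k : ℕ} {Q : Type*} (e : MSource k Q × MLabel k Q) : Option Letter :=
  match e.1, e.2.1.2.2 with
  | .inl _, _ => some .star
  | .inr _, .pop c => some c
  | .inr _, _ => none

theorem mem_srcStack {k : ℕ} [NeZero k] {Q : Type*} {e : MSource k Q × MLabel k Q}
    {π : ℕ → Letter} : π ∈ Automaton.srcStack e ↔ ∀ c ∈ edgeTop e, π 0 = c := by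
  obtain ⟨m | m, ⟨i, d, a⟩, q⟩ := e
  · simp [Automaton.srcStack, edgeTop, cyl]
  · cases a <;> simp [Automaton.srcStack, edgeTop, cyl, StackAct.dom]

/-- The vertex and the state at which an edge of the automaton starts determine its `MSource`. -/
theorem srcVertex_srcState_injective {k : ℕ} [NeZero k] {Q : Type*} [Fintype Q]
    (M : Automaton k Q) {m m' : MSource k Q}
    (hv : Automaton.srcVertex m = Automaton.srcVertex m') (hs : M.srcState m = M.srcState m') :
    m = m' := by
  obtain ⟨v, u⟩ | ⟨a, d, δ⟩ := m <;> obtain ⟨v', u'⟩ | ⟨a', d', δ'⟩ := m' <;>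
    simp_all [Automaton.srcVertex, Automaton.srcState]

namespace Automaton

variable {k : ℕ} [NeZero k] {Q : Type*} [Fintype Q] (M : Automaton k Q) (w : List Bool)

/-- An edge, of the automaton or of the word, is defined on a region. An edge of the automaton that
requires a top symbol is never defined on a region whose known stack is empty. -/
def Allows (S : Region k (w.length + 1) Q) : M.Edge ⊕ (Dir × Fin (w.length + 1)) → Prop
  | .inl e => S.vertex = srcVertex e.1.1 ∧ S.st = M.srcState e.1.1 ∧
      ∀ c ∈ edgeTop e.1, S.stack.head? = some c
  | .inr g => S.vertex = .ext (tape w g.2) g.1 ∧ S.pos 0 = g.2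

/-- The image of a region under an edge. -/
def move (S : Region k (w.length + 1) Q) :
    M.Edge ⊕ (Dir × Fin (w.length + 1)) → Region k (w.length + 1) Q
  | .inl e => ⟨M.tgtVertex e.1, M.tgtState e.1, fun j => S.pos ((M.edgePerm e.1)⁻¹ j),
      e.1.2.1.2.2.onList S.stack⟩
  | .inr g => ⟨.ext (tape w (g.1.move g.2)) g.1.flip, S.st,
      Function.update S.pos 0 (g.1.move g.2), S.stack⟩

/-- The successive edges of a path are defined on the successive images of a region. -/
def AllowsPath : Region k (w.length + 1) Q → List (M.Edge ⊕ (Dir × Fin (w.length + 1))) → Prop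
  | _, [] => True
  | S, e :: l => M.Allows w S e ∧ AllowsPath (M.move w S e) l

/-- The region in which a path ends. -/
def run : Region k (w.length + 1) Q → List (M.Edge ⊕ (Dir × Fin (w.length + 1))) →
    Region k (w.length + 1) Q
  | S, [] => S
  | S, e :: l => run (M.move w S e) l

/-- The region at which the paths of source `⟦a⟧_Y` start. -/
def startRegion (u : Letter) : Region k (w.length + 1) Q :=
  ⟨.res .acc, (M.qInit, 1, fun _ => Letter.star, u), fun _ => 0, [Letter.star]⟩

end Automaton

/-! ### Edges on regions and on points -/

theorem int_eq_of_mem_Ioo_of_mem_Icc {x : ℝ} {m n : ℤ} (h : x ∈ Set.Ioo (m : ℝ) (m + 1))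
    (h' : x ∈ Set.Icc (n : ℝ) (n + 1)) : m = n := by
  have h1 : (m : ℝ) < n + 1 := h.1.trans_le h'.2
  have h2 : (n : ℝ) < m + 1 := h'.1.trans_lt h.2
  norm_cast at h1 h2
  omega

theorem nat_eq_of_mem_Ioo_of_mem_Icc {x : ℝ} {m n N : ℕ} (hN : 0 < N)
    (h : x ∈ Set.Ioo (m / (N : ℝ)) ((m + 1) / (N : ℝ)))
    (h' : x ∈ Set.Icc (n / (N : ℝ)) ((n + 1) / (N : ℝ))) : m = n := by
  have hN' : (0 : ℝ) < N := by exact_mod_cast hN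
  have h1 := (div_lt_div_iff_of_pos_right hN').1 (h.1.trans_le h'.2)
  have h2 := (div_lt_div_iff_of_pos_right hN').1 (h'.1.trans_lt h.2)
  norm_cast at h1 h2
  omega

/-- Moving between cells of the word never wraps around `1`, so the fractional part is harmless. -/
theorem addFract_mem_Ioo {a : unitInterval} {N : ℕ} {p q : Fin N}
    (h : (a : ℝ) ∈ Set.Ioo ((p : ℕ) / (N : ℝ)) (((p : ℕ) + 1) / (N : ℝ))) :
    (addFract a ((((q : ℕ) : ℝ) - ((p : ℕ) : ℝ)) / N) : ℝ) ∈
      Set.Ioo ((q : ℕ) / (N : ℝ)) (((q : ℕ) + 1) / (N : ℝ)) := by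
  have hN : (0 : ℝ) < N := by exact_mod_cast p.pos
  have hq : ((q : ℕ) : ℝ) + 1 ≤ N := by exact_mod_cast q.2
  have h1 : ((q : ℕ) : ℝ) / N < a + (((q : ℕ) : ℝ) - ((p : ℕ) : ℝ)) / N := by
    have := h.1; rw [sub_div]; linarith
  have h2 : (a : ℝ) + (((q : ℕ) : ℝ) - ((p : ℕ) : ℝ)) / N < (((q : ℕ) : ℝ) + 1) / N := by
    have := h.2; rw [sub_div]; rw [add_div] at this ⊢; linarith
  have h0 : (0 : ℝ) ≤ ((q : ℕ) : ℝ) / N := by positivity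
  have h3 : (((q : ℕ) : ℝ) + 1) / N ≤ 1 := (div_le_one hN).2 hq
  have : Int.fract ((a : ℝ) + (((q : ℕ) : ℝ) - ((p : ℕ) : ℝ)) / N) =
      a + (((q : ℕ) : ℝ) - ((p : ℕ) : ℝ)) / N :=
    Int.fract_eq_self.2 ⟨by linarith, by linarith⟩
  exact ⟨by simpa only [addFract, this] using h1, by simpa only [addFract, this] using h2⟩

theorem viaEmbedding_valEmbedding_inv_apply {k : ℕ} (ρ : Equiv.Perm (Fin k)) (j : Fin k) :
    (ρ.viaEmbedding Fin.valEmbedding)⁻¹ (j : ℕ) = (ρ⁻¹ j : Fin k) := by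
  rw [Equiv.Perm.inv_eq_iff_eq]
  have := ρ.viaEmbedding_apply Fin.valEmbedding (ρ⁻¹ j)
  simpa using this.symm

theorem tail_prepend {γ : List Letter} (h : γ ≠ []) (π : ℕ → Letter) :
    tail (prepend γ π) = prepend γ.tail π := by
  cases γ with
  | nil => exact absurd rfl h
  | cons c γ => rfl

theorem prepend_apply_zero {γ : List Letter} {c : Letter} (h : γ.head? = some c)
    (π : ℕ → Letter) : prepend γ π 0 = c := by
  cases γ with
  | nil => simp at h
  | cons c' γ => exact Option.some.inj h

namespace Automaton

variable {k : ℕ} [NeZero k] {Q : Type*} [Fintype Q] {M : Automaton k Q} {w : List Bool}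
  {Ψ : Vertex → ℤ} {S : Region k (w.length + 1) Q}

/-- An edge that pops `c` is allowed on a region only if `c` is known to be on top of the stack; for
the edges of the initial state, `c` is `⋆`. -/
theorem Allows.head?_of_pop {e : M.Edge} (h : M.Allows w S (.inl e)) {c : Letter}
    (hc : e.1.2.1.2.2 = .pop c) : S.stack.head? = some c := by
  obtain ⟨⟨m | m, ⟨i, d, a⟩, q⟩, he⟩ := e
  · cases he.2 c hc
    exact h.2.2 _ rfl
  · subst hc
    exact h.2.2 _ rfl

theorem allows_inr_of_mem_edgeDom (hΨ : Function.Injective Ψ) {g : Dir × Fin (w.length + 1)}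
    {π : ℕ → Letter} {x : Pt} {δ : MState k Q} (hx : x ∈ S.pts Ψ π)
    (h : (x, δ, ()) ∈ edgeDom (M.graphing Ψ) (bang (wordGraphing Ψ w)) (.inr g)) :
    M.Allows w S (.inr g) := by
  obtain ⟨⟨hb, hp⟩, -⟩ := h
  refine ⟨hΨ (int_eq_of_mem_Ioo_of_mem_Icc hx.1 hb.1), Fin.ext ?_⟩
  exact nat_eq_of_mem_Ioo_of_mem_Icc (Nat.succ_pos _) (hx.2.1 0) hp

/-- The side condition excludes the case in which the required top symbol happens to be that of the
unknown part of the stack. -/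
theorem allows_inl_of_mem_edgeDom (hΨ : Function.Injective Ψ) {e : M.Edge}
    {π : ℕ → Letter} {x : Pt} (hx : x ∈ S.pts Ψ π)
    (h : (x, S.st, ()) ∈ edgeDom (M.graphing Ψ) (bang (wordGraphing Ψ w)) (.inl e))
    (hS : S.stack = [] → edgeTop e.1 = none) : M.Allows w S (.inl e) := by
  obtain ⟨hb, hs⟩ := h
  refine ⟨hΨ (int_eq_of_mem_Ioo_of_mem_Icc hx.1 hb.1), hs, fun c hc => ?_⟩
  have h0 := mem_srcStack.1 hb.2.2 c hc
  rw [hx.2.2] at h0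
  cases hγ : S.stack with
  | nil => simp [hS hγ] at hc
  | cons a γ => rw [hγ] at h0; exact congrArg some h0

/-- If an edge is not allowed on a region, then for some symbol `c` it is not defined at any point of the
region at which the unknown part of the stack does not start with `c`. -/
theorem exists_letter_notMem_edgeDom (hΨ : Function.Injective Ψ)
    {e : M.Edge ⊕ (Dir × Fin (w.length + 1))} (h : ¬ M.Allows w S e) :
    ∃ c : Letter, ∀ π : ℕ → Letter, π 0 ≠ c → ∀ x ∈ S.pts Ψ π,
      (x, S.st, ()) ∉ edgeDom (M.graphing Ψ) (bang (wordGraphing Ψ w)) e := by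
  rcases e with e | g
  · refine ⟨(edgeTop e.1).getD .star, fun π hπ x hx hd => ?_⟩
    by_cases hS : S.stack = []
    · cases ht : edgeTop e.1 with
      | none => exact h (allows_inl_of_mem_edgeDom hΨ hx hd fun _ => ht)
      | some c =>
        have h0 := mem_srcStack.1 hd.1.2.2 c ht
        rw [hx.2.2, hS] at h0
        simp only [ht, Option.getD_some] at hπ
        exact hπ h0
    · exact h (allows_inl_of_mem_edgeDom hΨ hx hd fun h' => absurd h' hS)
  · exact ⟨.star, fun π _ x hx hd => h (allows_inr_of_mem_edgeDom hΨ hx hd)⟩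

theorem Allows.mem_edgeDom {e : M.Edge ⊕ (Dir × Fin (w.length + 1))} (h : M.Allows w S e)
    {π : ℕ → Letter} {x : Pt} (hx : x ∈ S.pts Ψ π) :
    (x, S.st, ()) ∈ edgeDom (M.graphing Ψ) (bang (wordGraphing Ψ w)) e := by
  rcases e with e | g
  · refine ⟨⟨?_, trivial, mem_srcStack.2 fun c hc => ?_⟩, h.2.1⟩
    · rw [← h.1]; exact Set.Ioo_subset_Icc_self hx.1
    · rw [hx.2.2]; exact prepend_apply_zero (h.2.2 c hc) π
  · refine ⟨⟨⟨?_, trivial, trivial⟩, ?_⟩, rfl⟩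
    · rw [← h.1]; exact Set.Ioo_subset_Icc_self hx.1
    · have := Set.Ioo_subset_Icc_self (hx.2.1 0)
      rw [h.2] at this
      exact this

theorem translate_mem_Ioo {m n : ℤ} {x : ℝ} (h : x ∈ Set.Ioo (m : ℝ) (m + 1)) :
    x + ((n - m : ℤ) : ℝ) ∈ Set.Ioo (n : ℝ) (n + 1) := by
  push_cast
  exact ⟨by linarith [h.1], by linarith [h.2]⟩

theorem Allows.edgeMap_mem {e : M.Edge ⊕ (Dir × Fin (w.length + 1))} (h : M.Allows w S e)
    {π : ℕ → Letter} {x : Pt} (hx : x ∈ S.pts Ψ π) :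
    ∃ y ∈ (M.move w S e).pts Ψ π,
      edgeMap (M.graphing Ψ) (bang (wordGraphing Ψ w)) e (x, S.st, ()) =
        (y, (M.move w S e).st, ()) := by
  refine ⟨(edgeMap (M.graphing Ψ) (bang (wordGraphing Ψ w)) e (x, S.st, ())).1, ?_,
    by cases e <;> rfl⟩
  rcases e with e | g
  · have hmap : ∀ a : StackAct, (a.map x).1 = x.1 ∧ (a.map x).2.1 = x.2.1 := by
      intro a; cases a <;> exact ⟨rfl, rfl⟩
    have hst : (e.1.2.1.2.2.map x).2.2 = prepend (e.1.2.1.2.2.onList S.stack) π := by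
      cases ha : e.1.2.1.2.2 with
      | id => exact hx.2.2
      | pop c =>
        have := h.head?_of_pop ha
        change tail x.2.2 = _
        rw [hx.2.2]
        exact tail_prepend (by rintro h0; simp [h0] at this) π
      | push c => exact congrArg (cons c) hx.2.2
    refine ⟨?_, fun j => ?_, hst⟩
    · change (e.1.2.1.2.2.map x).1 + _ ∈ _
      rw [(hmap _).1, ← h.1]
      exact translate_mem_Ioo hx.1
    · change ((e.1.2.1.2.2.map x).2.1 (((M.edgePerm e.1).viaEmbedding Fin.valEmbedding)⁻¹ (j : ℕ)) : ℝ)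
        ∈ _
      rw [(hmap _).2, viaEmbedding_valEmbedding_inv_apply]
      exact hx.2.1 _
  · refine ⟨?_, fun j => ?_, hx.2.2⟩
    · change x.1 + _ ∈ _
      rw [← h.1]
      exact translate_mem_Ioo hx.1
    · by_cases hj : j = 0
      · subst hj
        have h0 := hx.2.1 0
        rw [h.2] at h0
        simpa [move, edgeMap, bang, cons, wordGraphing] using
          addFract_mem_Ioo (q := g.1.move g.2) h0
      · have h0 : (j : ℕ) ≠ 0 := fun h0 => hj (Fin.ext (by simpa using h0))
        obtain ⟨n, hn⟩ := Nat.exists_eq_succ_of_ne_zero h0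
        have h1 := hx.2.1 j
        simp only [move, Function.update_of_ne hj]
        rw [hn] at h1 ⊢
        exact h1

theorem AllowsPath.mem_pathDom {l : List (M.Edge ⊕ (Dir × Fin (w.length + 1)))}
    (h : M.AllowsPath w S l) {π : ℕ → Letter} {x : Pt} (hx : x ∈ S.pts Ψ π) :
    (x, S.st, ()) ∈ pathDom (M.graphing Ψ) (bang (wordGraphing Ψ w)) l := by
  induction l generalizing S x with
  | nil => trivial
  | cons e l ih =>
    obtain ⟨y, hy, he⟩ := h.1.edgeMap_mem hx
    refine ⟨h.1.mem_edgeDom hx, ?_⟩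
    rw [Set.mem_preimage, he]
    exact ih h.2 hy

theorem AllowsPath.pathMap_mem {l : List (M.Edge ⊕ (Dir × Fin (w.length + 1)))}
    (h : M.AllowsPath w S l) {π : ℕ → Letter} {x : Pt} (hx : x ∈ S.pts Ψ π) :
    (pathMap (M.graphing Ψ) (bang (wordGraphing Ψ w)) l (x, S.st, ())).1 ∈
      (M.run w S l).pts Ψ π := by
  induction l generalizing S x with
  | nil => exact hx
  | cons e l ih =>
    obtain ⟨y, hy, he⟩ := h.1.edgeMap_mem hx
    change (pathMap _ _ l (edgeMap _ _ e _)).1 ∈ _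
    rw [he]
    exact ih h.2 hy

/-- A path that cannot be followed on regions fails, because of its first edge that is not allowed, for
all but at most one value of the first unknown symbol of the stack. -/
theorem exists_letter_notMem_pathDom (hΨ : Function.Injective Ψ)
    {l : List (M.Edge ⊕ (Dir × Fin (w.length + 1)))} (h : ¬ M.AllowsPath w S l) :
    ∃ c : Letter, ∀ π : ℕ → Letter, π 0 ≠ c → ∀ x ∈ S.pts Ψ π,
      (x, S.st, ()) ∉ pathDom (M.graphing Ψ) (bang (wordGraphing Ψ w)) l := by
  induction l generalizing S with
  | nil => exact absurd trivial h
  | cons e l ih =>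
    by_cases he : M.Allows w S e
    · obtain ⟨c, hc⟩ := ih fun h' => h ⟨he, h'⟩
      refine ⟨c, fun π hπ x hx hd => ?_⟩
      obtain ⟨y, hy, hxy⟩ := he.edgeMap_mem hx
      have := hd.2
      rw [Set.mem_preimage, hxy] at this
      exact hc π hπ y hy this
    · obtain ⟨c, hc⟩ := exists_letter_notMem_edgeDom hΨ he
      exact ⟨c, fun π hπ x hx hd => hc π hπ x hx hd.1⟩

end Automaton

/-! ### Paths starting with an edge of the automaton -/

/-- Alternating lists starting on the left, by the number of rounds. -/
inductive StartsLeft {α β : Type*} : List (α ⊕ β) → Prop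
  | single (e : α) : StartsLeft [.inl e]
  | double (e : α) (g : β) : StartsLeft [.inl e, .inr g]
  | cons (e : α) (g : β) {l : List (α ⊕ β)} (h : StartsLeft l) : StartsLeft (.inl e :: .inr g :: l)

theorem StartsLeft.exists_eq_cons {α β : Type*} {l : List (α ⊕ β)} (h : StartsLeft l) :
    ∃ e l', l = .inl e :: l' := by
  cases h <;> exact ⟨_, _, rfl⟩

theorem StartsLeft.isAlternating {α β : Type*} {l : List (α ⊕ β)} (h : StartsLeft l) :
    IsAlternating l := by
  induction h with
  | single e => simp [IsAlternating]
  | double e g => simp [IsAlternating]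
  | cons e g h ih =>
    obtain ⟨e', l', rfl⟩ := h.exists_eq_cons
    simpa [IsAlternating] using ih.2

theorem IsAlternating.startsLeft {α β : Type*} : ∀ {e : α} {l : List (α ⊕ β)},
    IsAlternating (.inl e :: l) → StartsLeft (.inl e :: l)
  | e, [], _ => .single e
  | e, .inl _ :: _, h => by simp [IsAlternating] at h
  | e, [.inr g], _ => .double e g
  | e, .inr g :: .inr _ :: _, h => by simp [IsAlternating] at h
  | e, .inr g :: .inl e' :: l, h =>
    .cons e g (IsAlternating.startsLeft ⟨List.cons_ne_nil _ _, by
      have := h.2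
      simp only [List.isChain_cons_cons] at this
      exact this.2.2⟩)

/-! ### Configurations and regions -/

/-- The region `S` describes the configuration `c`, and the edges of the automaton that are defined on
`S` start at `m`. The position of the head `j` is held by the coordinate `σ(j)`, where `σ` is the
permutation in the state of `S`. -/
structure Matches {k : ℕ} [NeZero k] {Q : Type*} [Fintype Q] (M : Automaton k Q) (w : List Bool)
    (S : Region k (w.length + 1) Q) (c : Config k (w.length + 1) Q) (m : MSource k Q) : Prop where
  vertex : S.vertex = Automaton.srcVertex m
  st : S.st = M.srcState m
  state : (M.srcState m).1 = c.state
  reg : (M.srcState m).2.2.2 = c.reg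
  stack : S.stack = c.stack
  pos : ∀ j, S.pos ((M.srcState m).2.1 j) = c.pos j
  reading : Automaton.reading m = fun j => tape w (c.pos j)
  head?_stack : ∀ v, m = .inl v → c.stack.head? = some .star
  state_ne : ∀ p, m = .inr p → c.state ≠ M.qInit

namespace Automaton

theorem verdict_eq_acc {k : ℕ} {Q : Type*} [Fintype Q] {M : Automaton k Q} {q : Q} :
    M.verdict q = some .acc ↔ q = M.qAcc := by
  unfold verdict
  split_ifs <;> simp_all

theorem stepProb_eq_zero_of_verdict {k : ℕ} {Q : Type*} [Fintype Q] {M : Automaton k Q}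
    {w : List Bool} {c : Config k (w.length + 1) Q} (h : M.verdict c.state ≠ none)
    (t : Inst k × Q) :
    M.stepProb w c t = 0 := by
  unfold verdict at h
  unfold stepProb
  split_ifs at h with h1 h2
  · rw [h1]; exact M.prob_acc _ _ _
  · rw [h2]; exact M.prob_rej _ _ _
  · exact absurd rfl h

variable {k : ℕ} [NeZero k] {Q : Type*} [Fintype Q] {M : Automaton k Q} {w : List Bool}
  {S : Region k (w.length + 1) Q} {c c' : Config k (w.length + 1) Q} {m : MSource k Q}

theorem matches_start (u : Letter) :
    Matches M w (M.startRegion w u) (M.start w u) (.inl (.acc, u)) := by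
  constructor <;> first | rfl | (intro; rfl) | (intro _ _; rfl) | (intro _ h; cases h)

theorem _root_.Graphings.Matches.src_eq (h : Matches M w S c m) {e : M.Edge}
    (he : M.Allows w S (.inl e)) : e.1.1 = m :=
  srcVertex_srcState_injective M (he.1.symm.trans h.vertex) (he.2.1.symm.trans h.st)

theorem _root_.Graphings.Matches.weight_eq (h : Matches M w S c m) {e : M.Edge}
    (he : M.Allows w S (.inl e)) :
    M.prob (Automaton.reading e.1.1) (M.srcState e.1.1).2.2.2 (M.srcState e.1.1).1 e.1.2.trans =
      M.stepProb w c e.1.2.trans := by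
  rw [h.src_eq he, h.reading, h.reg, h.state]
  rfl

theorem _root_.Graphings.Matches.stepProb_pos (h : Matches M w S c m) {e : M.Edge}
    (he : M.Allows w S (.inl e)) : 0 < M.stepProb w c e.1.2.trans :=
  h.weight_eq he ▸ e.2.1

/-- Register and stack after the transition of an edge that is allowed on a matching region. -/
theorem _root_.Graphings.Matches.next_eq (h : Matches M w S c m) {e : M.Edge}
    (he : M.Allows w S (.inl e)) :
    c.next e.1.2.trans = some ⟨e.1.2.2,
      Function.update c.pos e.1.2.1.1 (e.1.2.1.2.1.move (c.pos e.1.2.1.1)),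
      e.1.2.1.2.2.reg c.reg, e.1.2.1.2.2.onList c.stack⟩ := by
  have hpop := fun a => he.head?_of_pop (c := a)
  obtain ⟨⟨m', ⟨i, d, a⟩, q⟩, he'⟩ := e
  cases a with
  | id => rfl
  | push a => rfl
  | pop a =>
    have h0 := hpop a rfl
    rw [h.stack] at h0
    obtain ⟨st, p, r, γ⟩ := c
    cases γ with
    | nil => simp at h0
    | cons b γ =>
      cases Option.some.inj h0
      rfl

/-- The edge of a transition that can be performed. -/
theorem _root_.Graphings.Matches.exists_edge (h : Matches M w S c m) {t : Inst k × Q}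
    (ht : 0 < M.stepProb w c t) (hc : c.next t = some c') :
    ∃ e : M.Edge, M.Allows w S (.inl e) ∧ e.1.2.trans = t := by
  obtain ⟨⟨i, d, o⟩, q⟩ := t
  have hp : ∀ a : StackAct, a.op = o →
      0 < M.prob (Automaton.reading m) (M.srcState m).2.2.2 (M.srcState m).1
        (MLabel.trans ((i, d, a), q)) := by
    rintro a rfl
    rw [h.reading, h.reg, h.state]
    exact ht
  obtain ⟨a, ha, hpop⟩ : ∃ a : StackAct, a.op = o ∧ ∀ b, a = .pop b → c.stack.head? = some b := by
    cases o with
    | id => exact ⟨.id, rfl, by simp⟩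
    | push b => exact ⟨.push b, rfl, by simp⟩
    | pop =>
      obtain ⟨st, p, r, γ⟩ := c
      cases γ with
      | nil => simp [Config.next, StackOp.exec] at hc
      | cons b γ => exact ⟨.pop b, rfl, by simp⟩
  rcases m with v | p
  · refine ⟨⟨(.inl v, (i, d, a), q), hp a ha, fun b hb => ?_⟩, ⟨h.vertex, h.st, ?_⟩, ?_⟩
    · exact Option.some.inj ((hpop b hb).symm.trans (h.head?_stack v rfl))
    · rintro b ⟨⟩
      exact h.stack ▸ h.head?_stack v rfl
    · subst ha; rfl
  · refine ⟨⟨(.inr p, (i, d, a), q), hp a ha, ?_⟩, ⟨h.vertex, h.st, fun b hb => ?_⟩, ?_⟩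
    · change (M.srcState (.inr p)).1 ≠ M.qInit
      rw [h.state]
      exact h.state_ne p rfl
    · rw [h.stack]
      refine hpop b ?_
      cases a <;> simp_all [edgeTop]
    · subst ha; rfl

theorem Allows.edge_unique {e e' : M.Edge} (h : M.Allows w S (.inl e))
    (h' : M.Allows w S (.inl e')) (ht : e.1.2.trans = e'.1.2.trans) : e = e' := by
  have hm : e.1.1 = e'.1.1 := srcVertex_srcState_injective M (h.1.symm.trans h'.1)
    (h.2.1.symm.trans h'.2.1)
  have hpop := fun a => h.head?_of_pop (c := a)
  have hpop' := fun a => h'.head?_of_pop (c := a)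
  obtain ⟨⟨m, ⟨i, d, a⟩, q⟩, he⟩ := e
  obtain ⟨⟨m', ⟨i', d', a'⟩, q'⟩, he'⟩ := e'
  simp only [MLabel.trans, Prod.mk.injEq] at ht hm
  obtain ⟨⟨rfl, rfl, ha⟩, rfl⟩ := ht
  subst hm
  have : a = a' := by
    cases a <;> cases a' <;> simp [StackAct.op] at ha ⊢
    · exact Option.some.inj ((hpop _ rfl).symm.trans (hpop' _ rfl))
    · exact ha
  subst this
  rfl

theorem Allows.word_unique {g g' : Dir × Fin (w.length + 1)} (h : M.Allows w S (.inr g))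
    (h' : M.Allows w S (.inr g')) : g = g' := by
  have := h.1.symm.trans h'.1
  simp only [Vertex.ext.injEq] at this
  exact Prod.ext this.2 (h.2.symm.trans h'.2)

/-- After an edge that enters a non-halting state, the region allows an edge of the word, and the image
under the latter describes the configuration after the transition. -/
theorem _root_.Graphings.Matches.round (h : Matches M w S c m) {e : M.Edge}
    (he : M.Allows w S (.inl e)) (hc : c.next e.1.2.trans = some c')
    (hv : M.verdict e.1.2.2 = none) :
    ∃ g, M.Allows w (M.move w S (.inl e)) (.inr g) ∧
      ∃ m', Matches M w (M.move w (M.move w S (.inl e)) (.inr g)) c' m' := by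
  have hm := h.src_eq he
  have hq : e.1.2.2 ≠ M.qInit := fun hq => by
    have := e.2.1
    rw [MLabel.trans, hq, M.prob_init] at this
    exact lt_irrefl _ this
  rw [h.next_eq he] at hc
  cases hc
  -- The moved head `i` sits in coordinate `σ(i)`, which the edge exchanges with the first one; there the
  -- edge of the word reads and shifts it.
  set i := e.1.2.1.1
  set d := e.1.2.1.2.1
  set σ := (M.srcState m).2.1
  have hpos0 : (M.move w S (.inl e)).pos 0 = c.pos i := by
    simp only [move, edgePerm, hv, hm, Equiv.swap_inv, Equiv.swap_apply_left]
    exact h.pos i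
  have hread : Automaton.reading e.1.1 i = tape w (c.pos i) := by rw [hm, h.reading]
  have hperm : M.edgePerm e.1 = Equiv.swap 0 (σ i) := by simp only [edgePerm, hv, hm, σ, i]
  have htgt : M.tgtState e.1 = (e.1.2.2, Equiv.swap 0 (σ i) * σ, Automaton.reading m,
      e.1.2.1.2.2.reg c.reg) := by
    simp only [tgtState, hv, hperm, hm]
    rw [h.reg]
  refine ⟨(d, c.pos i), ⟨?_, hpos0⟩, .inr (tape w (d.move (c.pos i)), d.flip, M.tgtState e.1),
    rfl, rfl, ?_, ?_, ?_, fun j => ?_, ?_, fun _ h => (Sum.inr_ne_inl h).elim, fun _ _ => hq⟩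
  · simp only [move, tgtVertex, hv]
    exact congrArg₂ Vertex.ext hread rfl
  · change (M.tgtState e.1).1 = _
    rw [htgt]
  · change (M.tgtState e.1).2.2.2 = _
    rw [htgt]
  · simp only [move, h.stack]
  · change Function.update (fun j => S.pos ((M.edgePerm e.1)⁻¹ j)) 0 (d.move (c.pos i))
      ((M.tgtState e.1).2.1 j) = Function.update c.pos i (d.move (c.pos i)) j
    rw [htgt, hperm, Equiv.swap_inv, Equiv.Perm.mul_apply]
    by_cases hj : j = i
    · rw [hj, Equiv.swap_apply_right, Function.update_self, Function.update_self]
    · have h1 : Equiv.swap 0 (σ i) (σ j) ≠ 0 := fun h0 => hj (σ.injective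
        ((Equiv.swap 0 (σ i)).injective (h0.trans (Equiv.swap_apply_right 0 (σ i)).symm)))
      rw [Function.update_of_ne h1, Function.update_of_ne hj, Equiv.swap_apply_self]
      exact h.pos j
  · have h1 : (Equiv.swap 0 (σ i) * σ)⁻¹ 0 = i := by
      rw [Equiv.Perm.inv_eq_iff_eq, Equiv.Perm.mul_apply, Equiv.swap_apply_right]
    change Function.update (M.tgtState e.1).2.2.1 ((M.tgtState e.1).2.1⁻¹ 0) _ = _
    rw [htgt]
    change Function.update (Automaton.reading m) ((Equiv.swap 0 (σ i) * σ)⁻¹ 0) _ = _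
    rw [h1, h.reading]
    funext j
    change _ = tape w (Function.update c.pos i (d.move (c.pos i)) j)
    by_cases hj : j = i
    · subst hj; rw [Function.update_self, Function.update_self]
    · rw [Function.update_of_ne hj, Function.update_of_ne hj]

theorem move_inl_vertex_of_verdict {e : M.Edge} {v : Verdict} (hv : M.verdict e.1.2.2 = some v) :
    (M.move w S (.inl e)).vertex = .res v := by
  simp only [move, tgtVertex, hv]

theorem verdict_eq_none_of_allows {e : M.Edge} {g : Dir × Fin (w.length + 1)}
    (h : M.Allows w (M.move w S (.inl e)) (.inr g)) : M.verdict e.1.2.2 = none := by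
  by_contra h0
  obtain ⟨v, hv⟩ := Option.ne_none_iff_exists'.1 h0
  have := h.1
  rw [move_inl_vertex_of_verdict hv] at this
  cases this

theorem move_inl_vertex_eq_acc {e : M.Edge} :
    (M.move w S (.inl e)).vertex = .res .acc ↔ e.1.2.2 = M.qAcc := by
  rw [← verdict_eq_acc]
  simp only [move, tgtVertex]
  cases h : M.verdict e.1.2.2 <;> simp

/-! ### Paths and computation traces -/

@[simp]
theorem pathTransitions_cons_inl {E' : Type*} (e : M.Edge) (l : List (M.Edge ⊕ E')) :
    M.pathTransitions (.inl e :: l) = e.1.2.trans :: M.pathTransitions l := by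
  simp [pathTransitions]

@[simp]
theorem pathTransitions_cons_inr {E' : Type*} (g : E') (l : List (M.Edge ⊕ E')) :
    M.pathTransitions (.inr g :: l) = M.pathTransitions l := rfl

@[simp]
theorem pathTransitions_nil {E' : Type*} : M.pathTransitions ([] : List (M.Edge ⊕ E')) = [] := rfl

theorem exists_path_of_isTrace {t : List (Inst k × Q)} (h : Matches M w S c m)
    (ht : M.IsTraceFrom w c t) (h0 : t ≠ []) :
    ∃ l, StartsLeft l ∧ Odd l.length ∧ M.AllowsPath w S l ∧ M.pathTransitions l = t := by
  induction t generalizing S c m with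
  | nil => exact absurd rfl h0
  | cons t s ih =>
    obtain ⟨hp, c', hc, hs⟩ := ht
    obtain ⟨e, he, rfl⟩ := h.exists_edge hp hc
    cases s with
    | nil => exact ⟨[.inl e], .single e, by simp, ⟨he, trivial⟩, by simp⟩
    | cons t' s =>
      -- A further transition follows, so the state entered is not halting.
      have hv : M.verdict e.1.2.2 = none := by
        by_contra hv
        have hst : c'.state = e.1.2.2 := by rw [h.next_eq he] at hc; cases hc; rfl
        have := hs.1
        rw [stepProb_eq_zero_of_verdict (hst ▸ hv)] at this
        exact lt_irrefl _ this
      obtain ⟨g, hg, m', hm'⟩ := h.round he hc hv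
      obtain ⟨l, hl, hodd, hal, htr⟩ := ih hm' hs (List.cons_ne_nil _ _)
      exact ⟨.inl e :: .inr g :: l, .cons e g hl, by simpa [parity_simps] using hodd,
        ⟨he, hg, hal⟩, by simp [htr]⟩

/-- A path of odd length is determined by the transitions of its edges. -/
theorem AllowsPath.path_unique {l l' : List (M.Edge ⊕ (Dir × Fin (w.length + 1)))}
    (hl : StartsLeft l) (hl' : StartsLeft l') (ho : Odd l.length) (ho' : Odd l'.length)
    (h : M.AllowsPath w S l) (h' : M.AllowsPath w S l')
    (ht : M.pathTransitions l = M.pathTransitions l') : l = l' := by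
  induction hl generalizing S l' with
  | single e =>
    cases hl' with
    | single e' => rw [h.1.edge_unique h'.1 (by simpa using ht)]
    | double e' g' => exact absurd ho' (show ¬ Odd 2 by decide)
    | cons e' g' hl' =>
      obtain ⟨e'', l'', rfl⟩ := hl'.exists_eq_cons
      simp at ht
  | double e g => exact absurd ho (show ¬ Odd 2 by decide)
  | cons e g hl ih =>
    cases hl' with
    | single e' =>
      obtain ⟨e'', l'', rfl⟩ := hl.exists_eq_cons
      simp at ht
    | double e' g' => exact absurd ho' (show ¬ Odd 2 by decide)
    | cons e' g' hl' =>
      simp only [pathTransitions_cons_inl, pathTransitions_cons_inr, List.cons.injEq] at ht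
      cases h.1.edge_unique h'.1 ht.1
      cases h.2.1.word_unique h'.2.1
      rw [ih hl' (by simpa [parity_simps] using ho) (by simpa [parity_simps] using ho')
        h.2.2 h'.2.2 ht.2]

/-- The transitions of a path of odd length form a trace; its weight, its length and whether it accepts
can be read off from the path. -/
theorem isTrace_of_allowsPath {l : List (M.Edge ⊕ (Dir × Fin (w.length + 1)))}
    (Ψ : Vertex → ℤ) (hl : StartsLeft l) (ho : Odd l.length) (hS : M.AllowsPath w S l)
    (h : Matches M w S c m) :
    M.IsTraceFrom w c (M.pathTransitions l) ∧
      pathWeight (M.graphing Ψ) (bang (wordGraphing Ψ w)) l =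
        (M.traceWeightFrom w c (M.pathTransitions l), 0) ∧
      l.length + 1 = 2 * (M.pathTransitions l).length ∧
      ((M.run w S l).vertex = .res .acc ↔
        (M.pathTransitions l).getLast?.map Prod.snd = some M.qAcc) := by
  induction hl generalizing S c m with
  | single e =>
    refine ⟨?_, ?_, ?_, ?_⟩
    · rw [pathTransitions_cons_inl]
      exact ⟨h.stepProb_pos hS.1, _, h.next_eq hS.1, trivial⟩
    · rw [pathTransitions_cons_inl, traceWeightFrom, h.next_eq hS.1]
      simp only [pathWeight, List.map_cons, List.map_nil, Sum.elim_inl, List.prod_cons,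
        List.prod_nil, mul_one, pathTransitions_nil, traceWeightFrom]
      exact congrArg₂ Prod.mk (h.weight_eq hS.1) rfl
    · simp
    · simpa [run, MLabel.trans] using move_inl_vertex_eq_acc
  | double e g => exact absurd ho (show ¬ Odd 2 by decide)
  | @cons e g l hl ih =>
    obtain ⟨g', hg', m', hm'⟩ := h.round hS.1 (h.next_eq hS.1) (verdict_eq_none_of_allows hS.2.1)
    cases hS.2.1.word_unique hg'
    obtain ⟨ih1, ih2, ih3, ih4⟩ := ih (by simpa [parity_simps] using ho) hS.2.2 hm'
    refine ⟨?_, ?_, ?_, ?_⟩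
    · rw [pathTransitions_cons_inl]
      exact ⟨h.stepProb_pos hS.1, _, h.next_eq hS.1, ih1⟩
    · rw [pathTransitions_cons_inl, traceWeightFrom, h.next_eq hS.1]
      simp only [pathTransitions_cons_inr]
      simp only [pathWeight, List.map_cons, Sum.elim_inl, Sum.elim_inr, List.prod_cons] at ih2 ⊢
      rw [ih2]
      -- The unit of `Ω` is `(1, 1)`: the second component is `0` because the path has an edge.
      change (_ * (1 * _), (0 * (0 * 0) : ZMod 2)) = _
      rw [one_mul, ← h.weight_eq hS.1]
      rfl
    · simp only [List.length_cons, pathTransitions_cons_inl, pathTransitions_cons_inr]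
      omega
    · obtain ⟨e', l', rfl⟩ := hl.exists_eq_cons
      simpa [run] using ih4

/-- A path of even length ends with an edge of the word, hence not at a result vertex. -/
theorem run_vertex_ne_of_even {l : List (M.Edge ⊕ (Dir × Fin (w.length + 1)))}
    (hl : StartsLeft l) (ho : ¬ Odd l.length) (v : Verdict) : (M.run w S l).vertex ≠ .res v := by
  induction hl generalizing S with
  | single e => simp at ho
  | double e g => simp [run, move]
  | cons e g hl ih => exact ih (by simpa [parity_simps] using ho)

end Automaton

/-! ### Generic points and sources of paths -/

theorem cons_zero_tail {α : Type*} (s : ℕ → α) : cons (s 0) (tail s) = s := by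
  funext n
  cases n <;> rfl

theorem ae_fst_ne (a : ℝ) : ∀ᵐ x ∂mu, x.1 ≠ a := by
  have h : ∀ᵐ y : ℝ ∂volume, y ≠ a := by simp [ae_iff]
  exact Measure.quasiMeasurePreserving_fst.ae h

theorem ae_coord_ne (n : ℕ) (a : ℝ) : ∀ᵐ x ∂mu, (x.2.1 n : ℝ) ≠ a := by
  have h : ∀ᵐ y : unitInterval ∂volume, (y : ℝ) ≠ a := by
    by_cases ha : a ∈ unitInterval
    · have : ∀ᵐ y : unitInterval ∂volume, y ≠ ⟨a, ha⟩ := by simp [ae_iff]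
      filter_upwards [this] with y hy h
      exact hy (Subtype.ext h)
    · exact Eventually.of_forall fun y h => ha (h ▸ y.2)
  have h1 := (measurePreserving_eval_infinitePi
    (fun _ : ℕ => (volume : Measure unitInterval)) n).quasiMeasurePreserving.ae h
  exact Measure.quasiMeasurePreserving_snd.ae (Measure.quasiMeasurePreserving_fst.ae h1)

namespace Automaton

variable {k : ℕ} {Q : Type*} [Fintype Q] {M : Automaton k Q} {w : List Bool}
  {Ψ : Vertex → ℤ} {u : Letter}

theorem startRegion_pts_subset (π : ℕ → Letter) :
    (M.startRegion w u).pts Ψ π ⊆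
      box Ψ (.res .acc) (cube k (w.length + 1)) (cyl .star) := by
  rintro x ⟨h1, h2, h3⟩
  refine ⟨Set.Ioo_subset_Icc_self h1, fun j hj => ?_, by rw [h3]; rfl⟩
  simpa [startRegion] using (h2 ⟨j, hj⟩).2.le

theorem mem_startRegion_pts {x : Pt} (hx : x ∈ ({M.startRegion w u with stack := []}).pts Ψ x.2.2)
    (h : x.2.2 ∈ cyl .star) : x ∈ (M.startRegion w u).pts Ψ (tail x.2.2) := by
  refine ⟨hx.1, hx.2.1, ?_⟩
  have h0 : x.2.2 0 = Letter.star := h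
  rw [← cons_zero_tail x.2.2, h0]
  rfl

/-- Almost every point of `⟦a⟧_Y` avoids the end points of the intervals. -/
theorem ae_mem_startRegion_pts : ∀ᵐ x ∂mu,
    x ∈ box Ψ (.res .acc) (cube k (w.length + 1)) Set.univ →
      x ∈ ({M.startRegion w u with stack := []}).pts Ψ x.2.2 := by
  have h0 : ∀ᵐ x ∂mu, ∀ n, (x.2.1 n : ℝ) ≠ 0 := ae_all_iff.2 fun n => ae_coord_ne n 0
  have h1 : ∀ᵐ x ∂mu, ∀ n, (x.2.1 n : ℝ) ≠ 1 / ((w.length + 1 : ℕ) : ℝ) :=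
    ae_all_iff.2 fun n => ae_coord_ne n _
  filter_upwards [h0, h1, ae_fst_ne (Ψ (.res .acc)), ae_fst_ne (Ψ (.res .acc) + 1)]
    with x h0 h1 h2 h3 hx
  refine ⟨⟨lt_of_le_of_ne hx.1.1 (Ne.symm h2), lt_of_le_of_ne hx.1.2 h3⟩, fun j => ?_, rfl⟩
  have h4 := lt_of_le_of_ne (hx.2.1 j j.2) (h1 j)
  have h5 : (0 : ℝ) < x.2.1 j := lt_of_le_of_ne (x.2.1 j).2.1 (Ne.symm (h0 j))
  constructor
  · simpa [startRegion] using h5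
  · simpa [startRegion] using h4

theorem _root_.Graphings.exists_letter_ne (c : Letter) : ∃ c' : Letter, c' ≠ c := by
  cases c
  · exact ⟨.zero, by simp⟩
  · exact ⟨.star, by simp⟩
  · exact ⟨.star, by simp⟩

theorem _root_.Graphings.volume_unitInterval_Ioo_ne_zero {b : ℝ} (hb : 0 < b) (hb1 : b ≤ 1) :
    (volume : Measure unitInterval) {y | (y : ℝ) ∈ Set.Ioo 0 b} ≠ 0 := by
  rw [unitInterval.volume_apply]
  have : Subtype.val '' {y : unitInterval | (y : ℝ) ∈ Set.Ioo 0 b} = Set.Ioo 0 b := by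
    ext y
    constructor
    · rintro ⟨z, hz, rfl⟩; exact hz
    · intro hy; exact ⟨⟨y, hy.1.le, hy.2.le.trans hb1⟩, hy, rfl⟩
  rw [this, Real.volume_Ioo]
  simpa using hb

/-- Any prescribed symbol lies directly below the top of the stack on a set of positive measure of
`⟦a⟧_Y^{V(⋆)}`. -/
theorem mu_startRegion_ne_zero (c : Letter) :
    mu {x | ∃ π : ℕ → Letter, π 0 = c ∧ x ∈ (M.startRegion w u).pts Ψ π} ≠ 0 := by
  set b : ℝ := 1 / ((w.length + 1 : ℕ) : ℝ)
  have hb : 0 < b := by positivity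
  have hb1 : b ≤ 1 := by
    rw [div_le_one (by positivity)]; exact_mod_cast Nat.succ_le_succ (Nat.zero_le _)
  let s1 : Set ℝ := Set.Ioo (Ψ (.res .acc) : ℝ) (Ψ (.res .acc) + 1)
  let s2 : Set (ℕ → unitInterval) :=
    Set.pi (Finset.range k) fun _ => {y : unitInterval | (y : ℝ) ∈ Set.Ioo 0 b}
  let s3 : Set (ℕ → Letter) := Set.pi (Finset.range 2) fun n => {if n = 0 then Letter.star else c}
  have hsub : s1 ×ˢ (s2 ×ˢ s3) ⊆
      {x | ∃ π : ℕ → Letter, π 0 = c ∧ x ∈ (M.startRegion w u).pts Ψ π} := by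
    rintro ⟨x, s, p⟩ ⟨h1, h2, h3⟩
    have hp0 : p 0 = Letter.star := by simpa using h3 0 (by simp)
    have hp1 : p 1 = c := by simpa using h3 1 (by simp)
    refine ⟨tail p, hp1, h1, fun j => ?_, ?_⟩
    · have := h2 (j : ℕ) (by simp)
      simpa [startRegion, b] using this
    · change p = cons Letter.star (tail p)
      rw [← hp0, cons_zero_tail]
  have hm : MeasurableSet {y : unitInterval | (y : ℝ) ∈ Set.Ioo 0 b} :=
    measurable_subtype_coe measurableSet_Ioo
  have hpos : mu (s1 ×ˢ (s2 ×ˢ s3)) ≠ 0 := by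
    unfold mu
    rw [Measure.prod_prod, Measure.prod_prod]
    refine mul_ne_zero ?_ (mul_ne_zero ?_ ?_)
    · simp [s1]
    · rw [Measure.infinitePi_pi _ (fun _ _ => hm), Finset.prod_ne_zero_iff]
      exact fun _ _ => volume_unitInterval_Ioo_ne_zero hb hb1
    · rw [Measure.infinitePi_pi _ (fun _ _ => MeasurableSet.of_discrete), Finset.prod_ne_zero_iff]
      intro n _
      rw [PMF.toMeasure_apply_singleton _ _ MeasurableSet.of_discrete]
      simp
  exact fun h => hpos (measure_mono_null hsub h)

variable [NeZero k]

theorem hasSource_iff_allowsPath (hΨ : Function.Injective Ψ)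
    {l : List (M.Edge ⊕ (Dir × Fin (w.length + 1)))} :
    HasSource (M.graphing Ψ) (bang (wordGraphing Ψ w))
      (box Ψ (.res .acc) (cube k (w.length + 1)) (cyl .star)) (M.startState u) l ↔
      M.AllowsPath w (M.startRegion w u) l := by
  constructor
  · intro h
    by_contra hl
    obtain ⟨c, hc⟩ := exists_letter_notMem_pathDom hΨ hl
    obtain ⟨c', hc'⟩ := exists_letter_ne c
    refine mu_startRegion_ne_zero (M := M) (w := w) (Ψ := Ψ) (u := u) c' (measure_mono_null ?_ h)
    rintro x ⟨π, rfl, hx⟩ hxl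
    exact hc π hc' x hx (hxl (startRegion_pts_subset π hx))
  · intro h
    filter_upwards [ae_mem_startRegion_pts (M := M) (w := w) (Ψ := Ψ) (u := u)] with x hx hB
    exact h.mem_pathDom (mem_startRegion_pts (hx ⟨hB.1, hB.2.1, trivial⟩) hB.2.2)

theorem hasTarget_iff (hΨ : Function.Injective Ψ)
    {l : List (M.Edge ⊕ (Dir × Fin (w.length + 1)))}
    (hl : M.AllowsPath w (M.startRegion w u) l) :
    HasTarget (M.graphing Ψ) (bang (wordGraphing Ψ w))
      (box Ψ (.res .acc) (cube k (w.length + 1)) (cyl .star)) (M.startState u)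
      (box Ψ (.res .acc) Set.univ Set.univ) l ↔
      (M.run w (M.startRegion w u) l).vertex = .res .acc := by
  constructor
  · intro h
    by_contra hv
    refine mu_startRegion_ne_zero (M := M) (w := w) (Ψ := Ψ) (u := u) .star (measure_mono_null ?_ h)
    rintro x ⟨π, -, hx⟩ hxl
    exact hv (hΨ (int_eq_of_mem_Ioo_of_mem_Icc (hl.pathMap_mem hx).1
      (hxl (startRegion_pts_subset π hx)).1))
  · intro h
    filter_upwards [ae_mem_startRegion_pts (M := M) (w := w) (Ψ := Ψ) (u := u)] with x hx hB
    have := (hl.pathMap_mem (mem_startRegion_pts (hx ⟨hB.1, hB.2.1, trivial⟩) hB.2.2)).1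
    rw [h] at this
    exact ⟨Set.Ioo_subset_Icc_self this, trivial, trivial⟩

theorem AllowsPath.startsLeft {l : List (M.Edge ⊕ (Dir × Fin (w.length + 1)))}
    (h : M.AllowsPath w (M.startRegion w u) l) (hl : IsAlternating l) : StartsLeft l := by
  rcases l with _ | ⟨e | g, l⟩
  · exact absurd rfl hl.1
  · exact hl.startsLeft
  · exact nomatch h.1.1

/-! ### Restoring the bottom of the stack -/

/-- The bottom of the stack is `⋆`, or else the stack is empty because `⋆` has just been popped. -/
def StarAtBottom (M : Automaton k Q) (c : Config k (w.length + 1) Q) : Prop :=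
  c.stack.getLast? = some .star ∨ (c.stack = [] ∧ c.reg = .star ∧
    ∃ s u q i d, 0 < M.prob s u q ((i, d, StackOp.pop), c.state))

/-- An automaton that restores `⋆` pops nothing from an empty stack: the transition that follows the
popping of the last `⋆` is a `push`. -/
theorem StarAtBottom.allows (hΨ : Function.Injective Ψ) (hM : M.RestoresStar)
    {S : Region k (w.length + 1) Q} {c : Config k (w.length + 1) Q} {m : MSource k Q}
    (h : Matches M w S c m) (hc : M.StarAtBottom c) {e : M.Edge} {π : ℕ → Letter} {x : Pt}
    (hx : x ∈ S.pts Ψ π)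
    (hd : (x, S.st, ()) ∈ edgeDom (M.graphing Ψ) (bang (wordGraphing Ψ w)) (.inl e)) :
    M.Allows w S (.inl e) := by
  refine allows_inl_of_mem_edgeDom hΨ hx hd fun hS => ?_
  rw [h.stack] at hS
  rcases hc with hc | ⟨-, hreg, s, u, q, i, d, hp⟩
  · simp [hS] at hc
  · have hm : e.1.1 = m := srcVertex_srcState_injective M
      ((hΨ (int_eq_of_mem_Ioo_of_mem_Icc hx.1 hd.1.1)).symm.trans h.vertex) (hd.2.symm.trans h.st)
    have he := e.2.1
    rw [hm, h.reg, h.state, hreg] at he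
    have hpush := hM _ _ _ _ _ _ hp _ _ _ _ _ he
    obtain ⟨⟨m', ⟨i', d', a⟩, q'⟩, he'⟩ := e
    rcases m with v | p
    · simpa [hS] using h.head?_stack v rfl
    · simp only at hm
      subst hm
      cases a with
      | push c => rfl
      | id => cases hpush
      | pop c => cases hpush

theorem StarAtBottom.next {S : Region k (w.length + 1) Q} {c c' : Config k (w.length + 1) Q}
    {m : MSource k Q} (hM : M.RestoresStar) (h : Matches M w S c m) (hc : M.StarAtBottom c)
    {e : M.Edge} (he : M.Allows w S (.inl e)) (hn : c.next e.1.2.trans = some c') :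
    M.StarAtBottom c' := by
  have hpop := fun a => he.head?_of_pop (c := a)
  have hpos := h.stepProb_pos he
  rw [h.next_eq he] at hn
  cases hn
  rw [h.stack] at hpop
  obtain ⟨⟨m', ⟨i, d, a⟩, q⟩, he'⟩ := e
  obtain ⟨st, p, r, γ⟩ := c
  have hpush : ∀ s u q' i' d', r = Letter.star → 0 < M.prob s u q' ((i', d', StackOp.pop), st) →
      a.op = .push .star := by
    rintro s u q' i' d' rfl hp
    exact hM _ _ _ _ _ _ hp _ _ _ _ _ hpos
  cases a with
  | id =>
    rcases hc with hc | ⟨-, hreg, s, u', q', i', d', hp⟩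
    · exact .inl hc
    · cases hpush _ _ _ _ _ hreg hp
  | push b =>
    rcases hc with hc | ⟨hnil, hreg, s, u', q', i', d', hp⟩
    · refine .inl ?_
      change (b :: γ).getLast? = _
      rw [List.getLast?_cons]
      simp only at hc
      rw [hc]
      rfl
    · have hb := hpush _ _ _ _ _ hreg hp
      cases hb
      simp only at hnil
      subst hnil
      exact .inl rfl
  | pop b =>
    have hb := hpop b rfl
    rcases γ with _ | ⟨b', γ⟩
    · simp at hb
    · cases Option.some.inj hb
      have hc : (b :: γ).getLast? = some .star := by
        rcases hc with hc | hc
        · exact hc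
        · exact absurd hc.1 (List.cons_ne_nil _ _)
      cases γ with
      | nil => exact .inr ⟨rfl, Option.some.inj hc, _, _, _, _, _, hpos⟩
      | cons b'' γ => exact .inl (by simpa [StackAct.onList] using hc)

theorem StarAtBottom.allowsPath (hΨ : Function.Injective Ψ) (hM : M.RestoresStar)
    {l : List (M.Edge ⊕ (Dir × Fin (w.length + 1)))} (hl : StartsLeft l)
    {S : Region k (w.length + 1) Q} {c : Config k (w.length + 1) Q} {m : MSource k Q}
    (h : Matches M w S c m) (hc : M.StarAtBottom c) {π : ℕ → Letter} {x : Pt} (hx : x ∈ S.pts Ψ π)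
    (hd : (x, S.st, ()) ∈ pathDom (M.graphing Ψ) (bang (wordGraphing Ψ w)) l) :
    M.AllowsPath w S l := by
  induction hl generalizing S c m x with
  | single e => exact ⟨hc.allows hΨ hM h hx hd.1, trivial⟩
  | double e g =>
    have he := hc.allows hΨ hM h hx hd.1
    obtain ⟨y, hy, hxy⟩ := he.edgeMap_mem hx
    have hd' := hd.2
    rw [Set.mem_preimage, hxy] at hd'
    exact ⟨he, allows_inr_of_mem_edgeDom hΨ hy hd'.1, trivial⟩
  | cons e g hl ih =>
    have he := hc.allows hΨ hM h hx hd.1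
    obtain ⟨y, hy, hxy⟩ := he.edgeMap_mem hx
    have hd' := hd.2
    rw [Set.mem_preimage, hxy] at hd'
    have hg := allows_inr_of_mem_edgeDom hΨ hy hd'.1
    obtain ⟨z, hz, hyz⟩ := hg.edgeMap_mem hy
    have hd'' := hd'.2
    rw [Set.mem_preimage, hyz] at hd''
    obtain ⟨g', hg', m', hm'⟩ := h.round he (h.next_eq he) (verdict_eq_none_of_allows hg)
    cases hg.word_unique hg'
    exact ⟨he, hg, ih hm' (hc.next hM h he (h.next_eq he)) hz hd''⟩

theorem hasSource_of_restoresStar (hΨ : Function.Injective Ψ) (hM : M.RestoresStar)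
    {l : List (M.Edge ⊕ (Dir × Fin (w.length + 1)))} (hl : IsAlternating l)
    (h : mu {x | x ∈ box Ψ (.res .acc) (cube k (w.length + 1)) Set.univ ∧
      (x, M.startState u) ∈ pathDom (M.graphing Ψ) (bang (wordGraphing Ψ w)) l} ≠ 0) :
    HasSource (M.graphing Ψ) (bang (wordGraphing Ψ w))
      (box Ψ (.res .acc) (cube k (w.length + 1)) (cyl .star)) (M.startState u) l := by
  rw [hasSource_iff_allowsPath hΨ]
  obtain ⟨x, ⟨hxB, hxl⟩, hx⟩ : ∃ x, (x ∈ box Ψ (.res .acc) (cube k (w.length + 1)) Set.univ ∧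
      (x, M.startState u) ∈ pathDom (M.graphing Ψ) (bang (wordGraphing Ψ w)) l) ∧
      x ∈ ({M.startRegion w u with stack := []}).pts Ψ x.2.2 := by
    by_contra! hn
    refine h (measure_mono_null ?_ (ae_mem_startRegion_pts (M := M) (w := w) (Ψ := Ψ) (u := u)))
    exact fun x hx hx' => hn x hx (hx' hx.1)
  -- The first edge starts at the vertex `a`, hence requires the top symbol `⋆`.
  rcases l with _ | ⟨e | g, l⟩
  · exact absurd rfl hl.1
  · have hv := hΨ (int_eq_of_mem_Ioo_of_mem_Icc hx.1 hxl.1.1.1)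
    have hstar : x.2.2 ∈ cyl .star := by
      have := hxl.1.1.2.2
      obtain ⟨⟨m | m, a⟩, he⟩ := e
      · exact this
      · cases hv
    exact StarAtBottom.allowsPath hΨ hM hl.startsLeft (matches_start u) (.inl rfl)
      (mem_startRegion_pts hx hstar) hxl
  · exact nomatch (allows_inr_of_mem_edgeDom hΨ hx hxl.1).1

end Automaton

/-! ### The acceptance probability as a sum over traces -/

open Classical in
/-- The lists of length at most `n`. -/
def listsUpTo (α : Type*) [Fintype α] : ℕ → Finset (List α)
  | 0 => {[]}
  | n + 1 => insert [] ((Finset.univ ×ˢ listsUpTo α n).image fun p => p.1 :: p.2)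

theorem mem_listsUpTo {α : Type*} [Fintype α] {n : ℕ} {l : List α} :
    l ∈ listsUpTo α n ↔ l.length ≤ n := by
  induction n generalizing l with
  | zero => simp [listsUpTo]
  | succ n ih => cases l <;> simp [listsUpTo, ih]

theorem sum_listsUpTo_succ {α : Type*} [Fintype α] (n : ℕ) (f : List α → ℝ≥0∞) :
    ∑ l ∈ listsUpTo α (n + 1), f l = f [] + ∑ a, ∑ l ∈ listsUpTo α n, f (a :: l) := by
  classical
  rw [listsUpTo, Finset.sum_insert (by simp), Finset.sum_image (by simp +contextual [Prod.ext_iff]),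
    Finset.sum_product]

namespace Automaton

theorem next_state {k n : ℕ} {Q : Type*} {c c' : Config k (n + 1) Q} {t : Inst k × Q}
    (h : c.next t = some c') : c'.state = t.2 := by
  obtain ⟨r, -, rfl⟩ := Option.map_eq_some_iff.1 h
  rfl

variable {k : ℕ} {Q : Type*} [Fintype Q] {M : Automaton k Q} {w : List Bool}

open Classical in
/-- The probability of performing a sequence of transitions and then being in the accepting state. -/
def acceptWeight (M : Automaton k Q) (w : List Bool) :
    Config k (w.length + 1) Q → List (Inst k × Q) → ℝ≥0∞
  | c, [] => if c.state = M.qAcc then 1 else 0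
  | c, t :: l => ENNReal.ofReal (M.stepProb w c t) *
      (match c.next t with
        | none => 0
        | some c' => acceptWeight M w c' l)

theorem acceptWithin_eq_sum (n : ℕ) (c : Config k (w.length + 1) Q) :
    M.acceptWithin w n c = ∑ l ∈ listsUpTo (Inst k × Q) n, M.acceptWeight w c l := by
  induction n generalizing c with
  | zero => simp [listsUpTo, acceptWithin, acceptWeight]
  | succ n ih =>
    rw [sum_listsUpTo_succ, acceptWithin]
    by_cases hc : c.state = M.qAcc
    · have h0 : ∀ t, M.stepProb w c t = 0 := fun t =>
        stepProb_eq_zero_of_verdict (by rw [verdict_eq_acc.2 hc]; simp) t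
      simp [acceptWeight, hc, h0]
    · rw [if_neg hc, acceptWeight, if_neg hc, zero_add]
      refine Finset.sum_congr rfl fun t _ => ?_
      simp only [acceptWeight]
      rw [← Finset.mul_sum]
      cases c.next t with
      | none => simp
      | some c' => simp only [ih]

theorem acceptProb_eq_tsum (u : Letter) :
    M.acceptProb w u = ∑' l, M.acceptWeight w (M.start w u) l := by
  rw [ENNReal.tsum_eq_iSup_sum' (listsUpTo (Inst k × Q)), acceptProb]
  · simp only [acceptWithin_eq_sum]
  · exact fun s => ⟨s.sup List.length, fun l hl => mem_listsUpTo.2 (Finset.le_sup hl)⟩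

open Classical in
theorem acceptWeight_eq (c : Config k (w.length + 1) Q) (l : List (Inst k × Q)) :
    M.acceptWeight w c l =
      if M.IsTraceFrom w c l ∧ (l.getLast?.map Prod.snd).getD c.state = M.qAcc then
        ENNReal.ofReal (M.traceWeightFrom w c l) else 0 := by
  induction l generalizing c with
  | nil => simp [acceptWeight, IsTraceFrom, traceWeightFrom]
  | cons t l ih =>
    rcases Option.eq_none_or_eq_some (c.next t) with hc | ⟨c', hc⟩
    · simp [acceptWeight, IsTraceFrom, hc]
    · simp only [acceptWeight, IsTraceFrom, traceWeightFrom, hc]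
      have hlast : ((t :: l).getLast?.map Prod.snd).getD c.state =
          (l.getLast?.map Prod.snd).getD c'.state := by
        rw [next_state hc, List.getLast?_cons]
        cases l.getLast? <;> rfl
      simp only [Option.some.injEq, exists_eq_left', ih, hlast]
      by_cases hp : 0 < M.stepProb w c t
      · simp only [hp, true_and, mul_ite, mul_zero]
        refine if_congr Iff.rfl ?_ rfl
        exact (ENNReal.ofReal_mul (M.stepProb w c t).2.1).symm
      · have h0 : M.stepProb w c t = 0 := le_antisymm (not_lt.1 hp) (M.stepProb w c t).2.1
        simp [h0]

theorem acceptProb_eq_tsum_traces (u : Letter) :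
    M.acceptProb w u = ∑' t : {t : List (Inst k × Q) |
        M.IsTraceFrom w (M.start w u) t ∧ t.getLast?.map Prod.snd = some M.qAcc},
      ENNReal.ofReal (M.traceWeightFrom w (M.start w u) t.1) := by
  classical
  rw [acceptProb_eq_tsum, tsum_subtype _ fun t =>
    ENNReal.ofReal (M.traceWeightFrom w (M.start w u) t)]
  refine tsum_congr fun t => ?_
  rw [acceptWeight_eq, Set.indicator_apply]
  refine if_congr (and_congr_right fun _ => ?_) rfl rfl
  rcases t.getLast? with _ | a
  · simpa [start] using M.init_ne_acc
  · simp

end Automaton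

/-! ### The bijection between traces and paths -/

namespace Automaton

variable {k : ℕ} [NeZero k] {Q : Type*} [Fintype Q] {M : Automaton k Q} {w : List Bool}
  {Ψ : Vertex → ℤ}

theorem bijOn_pathTransitions (hΨ : Function.Injective Ψ) (u : Letter) :
    Set.BijOn M.pathTransitions
      {l : List (M.Edge ⊕ (Dir × Fin (w.length + 1))) | IsAlternating l ∧ Odd l.length ∧
        HasSource (M.graphing Ψ) (bang (wordGraphing Ψ w))
          (box Ψ (.res .acc) (cube k (w.length + 1)) (cyl .star)) (M.startState u) l}
      {t | M.IsTraceFrom w (M.start w u) t ∧ t ≠ []} := by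
  simp only [hasSource_iff_allowsPath hΨ]
  refine ⟨?_, ?_, ?_⟩
  · rintro l ⟨ha, ho, hl⟩
    obtain ⟨h1, -, h3, -⟩ := isTrace_of_allowsPath Ψ (hl.startsLeft ha) ho hl (matches_start u)
    refine ⟨h1, fun h0 => ?_⟩
    rw [h0] at h3
    simp at h3
  · rintro l ⟨ha, ho, hl⟩ l' ⟨ha', ho', hl'⟩ ht
    exact hl.path_unique (hl.startsLeft ha) (hl'.startsLeft ha') ho ho' hl' ht
  · rintro t ⟨ht, h0⟩
    obtain ⟨l, hs, ho, hl, htr⟩ := exists_path_of_isTrace (matches_start u) ht h0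
    exact ⟨l, ⟨hs.isAlternating, ho, hl⟩, htr⟩

/-- Weight, length and target of a path, in terms of its trace. -/
theorem path_properties (hΨ : Function.Injective Ψ) {u : Letter}
    {l : List (M.Edge ⊕ (Dir × Fin (w.length + 1)))} (ha : IsAlternating l) (ho : Odd l.length)
    (hl : HasSource (M.graphing Ψ) (bang (wordGraphing Ψ w))
      (box Ψ (.res .acc) (cube k (w.length + 1)) (cyl .star)) (M.startState u) l) :
    pathWeight (M.graphing Ψ) (bang (wordGraphing Ψ w)) l =
        (M.traceWeightFrom w (M.start w u) (M.pathTransitions l), 0) ∧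
      l.length + 1 = 2 * (M.pathTransitions l).length ∧
      (HasTarget (M.graphing Ψ) (bang (wordGraphing Ψ w))
        (box Ψ (.res .acc) (cube k (w.length + 1)) (cyl .star)) (M.startState u)
        (box Ψ (.res .acc) Set.univ Set.univ) l ↔
        (M.pathTransitions l).getLast?.map Prod.snd = some M.qAcc) := by
  rw [hasSource_iff_allowsPath hΨ] at hl
  rw [hasTarget_iff hΨ hl]
  exact (isTrace_of_allowsPath Ψ (hl.startsLeft ha) ho hl (matches_start u)).2

theorem odd_length_of_hasTarget (hΨ : Function.Injective Ψ) {u : Letter}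
    {l : List (M.Edge ⊕ (Dir × Fin (w.length + 1)))} (ha : IsAlternating l)
    (hl : HasSource (M.graphing Ψ) (bang (wordGraphing Ψ w))
      (box Ψ (.res .acc) (cube k (w.length + 1)) (cyl .star)) (M.startState u) l)
    (ht : HasTarget (M.graphing Ψ) (bang (wordGraphing Ψ w))
      (box Ψ (.res .acc) (cube k (w.length + 1)) (cyl .star)) (M.startState u)
      (box Ψ (.res .acc) Set.univ Set.univ) l) : Odd l.length := by
  rw [hasSource_iff_allowsPath hΨ] at hl
  rw [hasTarget_iff hΨ hl] at ht
  by_contra ho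
  exact run_vertex_ne_of_even (hl.startsLeft ha) ho .acc ht

theorem bijOn_pathTransitions_acc (hΨ : Function.Injective Ψ) (u : Letter) :
    Set.BijOn M.pathTransitions
      {l : List (M.Edge ⊕ (Dir × Fin (w.length + 1))) | IsAlternating l ∧
        HasSource (M.graphing Ψ) (bang (wordGraphing Ψ w))
          (box Ψ (.res .acc) (cube k (w.length + 1)) (cyl .star)) (M.startState u) l ∧
        HasTarget (M.graphing Ψ) (bang (wordGraphing Ψ w))
          (box Ψ (.res .acc) (cube k (w.length + 1)) (cyl .star)) (M.startState u)
          (box Ψ (.res .acc) Set.univ Set.univ) l}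
      {t | M.IsTraceFrom w (M.start w u) t ∧ t.getLast?.map Prod.snd = some M.qAcc} := by
  have hb := bijOn_pathTransitions (M := M) (w := w) hΨ u
  refine ⟨?_, hb.injOn.mono ?_, ?_⟩
  · rintro l ⟨ha, hl, ht⟩
    have ho := odd_length_of_hasTarget hΨ ha hl ht
    exact ⟨(hb.mapsTo ⟨ha, ho, hl⟩).1, (path_properties hΨ ha ho hl).2.2.1 ht⟩
  · rintro l ⟨ha, hl, ht⟩
    exact ⟨ha, odd_length_of_hasTarget hΨ ha hl ht, hl⟩
  · rintro t ⟨ht, hacc⟩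
    obtain ⟨l, ⟨ha, ho, hl⟩, rfl⟩ := hb.surjOn ⟨ht, by rintro rfl; simp at hacc⟩
    exact ⟨l, ⟨ha, hl, (path_properties hΨ ha ho hl).2.2.2 hacc⟩, rfl⟩

end Automaton
end Graphings
end

theorem mainTheorem8 {k : ℕ} [NeZero k] {Q : Type*} [Fintype Q] (M : Automaton k Q)
    (Ψ : Vertex → ℤ) (hΨ : Function.Injective Ψ) (w : List Bool) (u : Letter) :
    let F := M.graphing Ψ
    let G := bang (wordGraphing Ψ w)
    let Y := cube k (w.length + 1)
    let B := box Ψ (.res .acc) Y (cyl .star)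
    let A := box Ψ (.res .acc) Set.univ Set.univ
    let δ := M.startState u
    (∃ Φ : {t : List (Inst k × Q) // M.IsTraceFrom w (M.start w u) t ∧ t ≠ []} ≃
        {l : List (M.Edge ⊕ (Dir × Fin (w.length + 1))) //
          IsAlternating l ∧ Odd l.length ∧ HasSource F G B δ l},
      ∀ t, pathWeight F G (Φ t).1 = (M.traceWeightFrom w (M.start w u) t.1, 0) ∧
        (Φ t).1.length + 1 = 2 * t.1.length ∧
        M.pathTransitions (Φ t).1 = t.1 ∧
        (HasTarget F G B δ A (Φ t).1 ↔ t.1.getLast?.map Prod.snd = some M.qAcc)) ∧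
    M.acceptProb w u =
      ∑' l : {l : List (M.Edge ⊕ (Dir × Fin (w.length + 1))) //
          IsAlternating l ∧ HasSource F G B δ l ∧ HasTarget F G B δ A l},
        ENNReal.ofReal (pathWeight F G l.1).1 ∧
    (M.RestoresStar →
      ∀ l : List (M.Edge ⊕ (Dir × Fin (w.length + 1))), IsAlternating l →
        mu {x | x ∈ box Ψ (.res .acc) Y Set.univ ∧ (x, δ) ∈ pathDom F G l} ≠ 0 →
        HasSource F G B δ l) := by
  intro F G Y B A δ
  refine ⟨?_, ?_, fun hM l hl h => Automaton.hasSource_of_restoresStar hΨ hM hl h⟩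
  · have hb := Automaton.bijOn_pathTransitions (M := M) (w := w) hΨ u
    refine ⟨(hb.equiv _).symm, fun t => ?_⟩
    obtain ⟨l, rfl⟩ := (hb.equiv _).surjective t
    have hp := Automaton.path_properties hΨ l.2.1 l.2.2.1 l.2.2.2
    rw [Equiv.symm_apply_apply]
    exact ⟨hp.1, hp.2.1, rfl, hp.2.2⟩
  · rw [Automaton.acceptProb_eq_tsum_traces,
      ← ((Automaton.bijOn_pathTransitions_acc (M := M) (w := w) hΨ u).equiv _).tsum_eq]
    refine tsum_congr fun l => ?_
    have ho := Automaton.odd_length_of_hasTarget hΨ l.2.1 l.2.2.1 l.2.2.2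
    exact congrArg (fun x : Weight => ENNReal.ofReal x.1)
      (Automaton.path_properties hΨ l.2.1 ho l.2.2.1).1.symm
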